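/- Let $g\ge 2$ and let $\Gamma=\langle a_1,b_1,\dots,a_g,b_g \mid \prod_{i=1}^g a_ib_ia_i^{-1}b_i^{-1}=1\rangle$ be the fundamental group of the sphere with $g$ handles. For a finite family $S=(s_i)$ of elements generating $\Gamma$, $\mathrm{Cay}(\Gamma,S)$ is the oriented graph with vertex set $\Gamma$ and an edge from $h$ to $hs_i$ for all $h\in\Gamma$ and all $i$. For an oriented graph with vertex set $V$ and edge set $E$ with bounded degrees, let $(\partial f)(v)=\sum_{\mathrm{end}\,e=v}f(e)-\sum_{\mathrm{begin}\,e=v}f(e)$ for $f\colon E\to\mathbb R$, and let $\ell^2_{0,c}(E)$ be the closure in $\ell^2(E)$ of the set of finitely supported $f\colon E\to\mathbb R$ with $\partial f=0$. Canonical tessellation. Let $P$ be a $4g$-gon with corners $c_k$ and sides $[c_k,c_{k+1}]$, $k\in\mathbb Z/4g$ (in one of the two cyclic orders). The canonical tessellation consists of tiles $hP$, $h\in\Gamma$, where $P$ has common sides, number $0,1,\dots,4g-1$ respectively, with $a_1P,\,b_1^{-1}P,\,a_1^{-1}P,\,b_1P,\,a_2P,\dots,b_gP$ (for $0\le i<g$,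 $a_{i+1}$ maps side $4i+2$ onto side $4i$, by $c_{4i+2}\mapsto c_{4i+1}$, $c_{4i+3}\mapsto c_{4i}$, and $b_{i+1}$ maps side $4i+1$ onto side $4i+3$, by $c_{4i+1}\mapsto c_{4i+4}$, $c_{4i+2}\mapsto c_{4i+3}$), and correspondingly for the translates. It may be taken either (a) as any tessellation of the hyperbolic plane $\mathbb H$ by the images of a hyperbolic $4g$-gon $P$ under a free action of $\Gamma$ on $\mathbb H$ by orientation-preserving isometries, with this pairing of sides, or (b) as the abstract complex obtained from the disjoint union of the polygons $hP$, $h\in\Gamma$, by gluing them along these common sides. Let $\mathscr V$ be its set of vertices. The edge of $\mathrm{Cay}(\Gamma)$ (with respect to $a_1,b_1,\dots,a_g,b_g$) from $h$ to $hx$ crosses the common side of $hP$ and $hxP$. 1. For both (a) and (b): for each $v\in\mathscr V$ there is a loop in $\mathrm{Cay}(\Gamma)$, considered without orientation of edges, that passes exactly once through each $h$ such that $v$ is a vertex of $hP$, and through no other vertices, each of its edges crossing a side with endpoint $v$. Choose such a loop, with any direction, for each $v$, and let $\gamma_v$ be the $1$-chain equal to $+1$ at edges that the loop passes in their direction, $-1$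 at edges that it passes in the reversed direction, and $0$ at other edges. Then $\{\gamma_v\}_{v\in\mathscr V}$ is a Riesz basis in $\ell^2_{0,c}(E)$: its closed linear span is $\ell^2_{0,c}(E)$, and for some $C\in(0,\infty)$ and all finitely supported real families $(\alpha_v)$, $$C^{-1}\sum_v \alpha_v^2\le\Big\|\sum_v \alpha_v\gamma_v\Big\|^2\le C\sum_v \alpha_v^2 .$$ 2. For any finite generating family $S$ of $\Gamma$, the graph $G=\mathrm{Cay}(\Gamma,S)$ has a coexact $1$-Laplacian spectral gap. That is, for $D\in\mathbb N$ let $G^{(2)}_D$ be the $2$-complex obtained by gluing a polygon to each cycle (simple loop) of length at most $D$ of $G$ considered without orientation of edges. Then $G^{(2)}_D$ is simply connected for some $D$; and whenever $G^{(2)}_D$ is simply connected, the Hodge Laplacian $\Delta_1=\partial d+d\partial$ of $G^{(2)}_D$ is a bounded operator on $\ell^2_{0,c}(E)$ with $\mathrm{spec}\big(\Delta_1|_{\ell^2_{0,c}(E)}\big)\cap[0,\varepsilon)=\varnothing$ for some $\varepsilon>0$. -/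

import Mathlib

noncomputable section

namespace CoexactGap

/-! ### Oriented graphs, walks and cycles -/

/-- An oriented multigraph: every edge `e` goes from `beg e` to `ennd e`. -/
structure OrientedGraph (V E : Type*) where
  beg : E → V
  ennd : E → V

namespace OrientedGraph

variable {V E : Type*} (G : OrientedGraph V E)

/-- Starting vertex of a passage `d` of an edge: `(e, true)` is the passage of `e` in its own
direction, `(e, false)` the passage in the reversed direction. -/
def src (d : E × Bool) : V := if d.2 then G.beg d.1 else G.ennd d.1

/-- Final vertex of a passage of an edge. -/
def tgt (d : E × Bool) : V := if d.2 then G.ennd d.1 else G.beg d.1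

/-- `l` is a path from `u` to `v` in the graph obtained by forgetting the orientation. -/
def IsWalk : V → List (E × Bool) → V → Prop
  | u, [], v => u = v
  | u, d :: l, v => G.src d = u ∧ IsWalk (G.tgt d) l v

/-- `w` is a cycle (simple loop) in the graph obtained by forgetting the orientation: a non-trivial
closed path that repeats neither a vertex nor an edge. -/
def IsCycle (w : List (E × Bool)) : Prop :=
  w ≠ [] ∧ (∃ v, G.IsWalk v w v) ∧ (w.map G.src).Nodup ∧ (w.map Prod.fst).Nodup

open Classical in
/-- The 1-chain of a path: number of passes of `e` in its direction minus number of passes of `e`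
in its reversed direction. -/
def walkChain (w : List (E × Bool)) (e : E) : ℝ :=
  (w.count (e, true) : ℝ) - (w.count (e, false) : ℝ)

/-! ### The 2-complex obtained by gluing a polygon to every cycle of length at most `D` -/

/-- The faces: one for each cycle of length at most `D`. A cycle, regardless of its starting point
and of its direction, is the same thing as its set of edges. -/
def Face (D : ℕ) : Type _ :=
  {c : Set E // ∃ w, G.IsCycle w ∧ w.length ≤ D ∧ c = {e | e ∈ w.map Prod.fst}}

/-- The boundary of a face, with respect to some chosen orientation of the face. -/
def Face.boundaryWalk {G : OrientedGraph V E} {D : ℕ} (c : G.Face D) : List (E × Bool) :=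
  Classical.choose c.2

/-- Elementary homotopies of paths from `u` to `v` in the 2-complex: removal of a backtracking, and
contraction of the boundary of a face. -/
inductive HomotopyStep (D : ℕ) (u v : V) : List (E × Bool) → List (E × Bool) → Prop
  | backtrack (p q : List (E × Bool)) (e : E) (b : Bool) :
      G.IsWalk u (p ++ [(e, b), (e, !b)] ++ q) v →
      HomotopyStep D u v (p ++ [(e, b), (e, !b)] ++ q) (p ++ q)
  | face (p w q : List (E × Bool)) :
      G.IsWalk u (p ++ w ++ q) v → G.IsCycle w → w.length ≤ D →
      HomotopyStep D u v (p ++ w ++ q) (p ++ q)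

/-- The 2-complex is simply connected: it is connected and every closed edge path is
null-homotopic. -/
def IsSimplyConnected (D : ℕ) : Prop :=
  (∀ u v, ∃ l, G.IsWalk u l v) ∧
    ∀ v l, G.IsWalk v l v → Relation.EqvGen (G.HomotopyStep D v v) l []

/-! ### Cochains, differentials and boundary operators -/

/-- `d` on 0-cochains. -/
def d0 (u : V → ℝ) (e : E) : ℝ := u (G.ennd e) - u (G.beg e)

/-- `∂` on 1-cochains (the sums are finite in a locally finite graph). -/
def bd1 (f : E → ℝ) (v : V) : ℝ :=
  (∑ᶠ (e : E) (_ : e ∈ {e | G.ennd e = v}), f e) - ∑ᶠ (e : E) (_ : e ∈ {e | G.beg e = v}), f e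

/-- `d` on 1-cochains: the integral of `f` along the boundary of a face. -/
def d1 (D : ℕ) (f : E → ℝ) (c : G.Face D) : ℝ :=
  (c.boundaryWalk.map fun p => if p.2 then f p.1 else -f p.1).sum

/-- `∂` on 2-cochains (the sum is finite in a locally finite graph). -/
def bd2 (D : ℕ) (φ : G.Face D → ℝ) (e : E) : ℝ :=
  ∑ᶠ c : G.Face D, φ c * walkChain c.boundaryWalk e

/-- The Hodge Laplacian `∂d + d∂` on 1-cochains. -/
def hodgeLaplacian (D : ℕ) (f : E → ℝ) (e : E) : ℝ :=
  G.bd2 D (G.d1 D f) e + G.d0 (G.bd1 f) e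

/-- The finitely supported `f ∈ ℓ²(E)` with `∂f = 0`. -/
def finiteCycles : Submodule ℝ (lp (fun _ : E => ℝ) 2) where
  carrier := {f | (Function.support (f : E → ℝ)).Finite ∧ ∀ v, G.bd1 f v = 0}
  zero_mem' := by
    refine ⟨?_, fun v => by simp [bd1]⟩
    rw [lp.coeFn_zero, Function.support_zero]
    exact Set.finite_empty
  add_mem' := by
    rintro f f₁ ⟨hf, hf0⟩ ⟨hf₁, hf₁0⟩
    refine ⟨(hf.union hf₁).subset ?_, fun v => ?_⟩
    · rw [lp.coeFn_add]
      exact Function.support_add (f : E → ℝ) (f₁ : E → ℝ)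
    · have key : ∀ s : Set E, (∑ᶠ (e : E) (_ : e ∈ s), (f + f₁) e) =
          (∑ᶠ (e : E) (_ : e ∈ s), f e) + ∑ᶠ (e : E) (_ : e ∈ s), f₁ e := fun s => by
        simp only [lp.coeFn_add, Pi.add_apply]
        exact finsum_mem_add_distrib' (hf.subset (by simp)) (hf₁.subset (by simp))
      have h1 := hf0 v
      have h2 := hf₁0 v
      simp only [bd1] at h1 h2 ⊢
      rw [key, key]
      linarith
  smul_mem' := by
    rintro c f ⟨hf, hf0⟩
    refine ⟨hf.subset ?_, fun v => ?_⟩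
    · rw [lp.coeFn_smul]
      exact Function.support_const_smul_subset c (f : E → ℝ)
    · have key : ∀ s : Set E, (∑ᶠ (e : E) (_ : e ∈ s), (c • f) e) =
          c * ∑ᶠ (e : E) (_ : e ∈ s), f e := fun s => by
        simp only [lp.coeFn_smul, Pi.smul_apply, ← smul_eq_mul, smul_finsum]
      have h1 := hf0 v
      simp only [bd1] at h1 ⊢
      rw [key, key, ← mul_sub, h1, mul_zero]

/-- `ℓ²_{0,c}(E)`: the closure in `ℓ²(E)` of the finitely supported `f` with `∂f = 0`. -/
def l2c : Submodule ℝ (lp (fun _ : E => ℝ) 2) := G.finiteCycles.topologicalClosure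

/-- Coexact 1-Laplacian spectral gap: the Hodge Laplacian is a bounded operator on `ℓ²_{0,c}(E)`
whose spectrum avoids `[0, ε)` for some `ε > 0`. -/
def HasCoexactSpectralGap (D : ℕ) : Prop :=
  ∃ Δ : G.l2c →L[ℝ] G.l2c,
    (∀ (f : G.l2c) (e : E),
      (Δ f : lp (fun _ : E => ℝ) 2) e = G.hodgeLaplacian D (f : lp (fun _ : E => ℝ) 2) e) ∧
    ∃ ε : ℝ, 0 < ε ∧ spectrum ℝ Δ ∩ Set.Ico 0 ε = ∅

end OrientedGraph

/-- The Cayley graph of `Γ` with respect to the system `s`: the edge `(h, i)` goes from `h` to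
`h * s i`. -/
def cayley {Γ ι : Type*} [Group Γ] (s : ι → Γ) : OrientedGraph Γ (Γ × ι) where
  beg e := e.1
  ennd e := e.1 * s e.2

/-! ### Riesz bases -/

/-- Almost-orthogonality on finitely supported families of coefficients. -/
def IsRieszSystem {ι H : Type*} [NormedAddCommGroup H] [InnerProductSpace ℝ H]
    (f : ι → H) : Prop :=
  ∃ C : ℝ, 0 < C ∧ ∀ a : ι →₀ ℝ,
    C⁻¹ * (a.sum fun _ x => x ^ 2) ≤ ‖a.sum fun i x => x • f i‖ ^ 2 ∧
      ‖a.sum fun i x => x • f i‖ ^ 2 ≤ C * a.sum fun _ x => x ^ 2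

/-- A Riesz basis is a complete Riesz system. -/
def IsRieszBasis {ι H : Type*} [NormedAddCommGroup H] [InnerProductSpace ℝ H]
    (f : ι → H) : Prop :=
  IsRieszSystem f ∧ (Submodule.span ℝ (Set.range f)).topologicalClosure = ⊤

/-! ### Surface groups -/

/-- The canonical generators: `(i, false)` stands for `a_i`, and `(i, true)` for `b_i`, where the
indices run from `0` to `g - 1`. -/
abbrev Gen (g : ℕ) : Type := Fin g × Bool

/-- The word `[a_0, b_0] ⋯ [a_{g-1}, b_{g-1}]`, where `[a, b] = a b a⁻¹ b⁻¹`. -/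
def surfaceRelator (g : ℕ) : FreeGroup (Gen g) :=
  ((List.finRange g).map fun i =>
    (FreeGroup.of (i, false) * FreeGroup.of (i, true) *
      (FreeGroup.of (i, false))⁻¹ * (FreeGroup.of (i, true))⁻¹ : FreeGroup (Gen g))).prod

/-- The fundamental group of the sphere with `g` handles. -/
abbrev SurfaceGroup (g : ℕ) : Type := PresentedGroup ({surfaceRelator g} : Set (FreeGroup (Gen g)))

/-- The canonical system of generators of the surface group. -/
def gen {g : ℕ} : Gen g → SurfaceGroup g := PresentedGroup.of

/-! ### Tessellations by `4g`-gons

The tiles are the copies `hP`, `h ∈ Γ`, of one polygon `P` with corners `c_k` and sides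
`[c_k, c_{k+1}]`, where `k ∈ ℤ/4g`. The neighbours of `P` across its consecutive sides are
`a_0 P, b_0⁻¹ P, a_0⁻¹ P, b_0 P, a_1 P, b_1⁻¹ P, …`; that is, the side number `4i` of `P` is its
common side with `a_i P`, and is the image under `a_i` of the side number `4i + 2`, while the side
number `4i + 3` is the common side with `b_i P`, and is the image under `b_i` of the side number
`4i + 1`. (Walking around a vertex one then reads the word `[a_0, b_0] ⋯ [a_{g-1}, b_{g-1}]`.) -/

/-- The residue of `4 i + r` modulo `4 g`. -/
def idx {g : ℕ} (i : Fin g) (r : ℕ) : ZMod (4 * g) := ((4 * (i : ℕ) + r : ℕ) : ZMod (4 * g))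

/-- The number of the side of `P` that is common with the tile `x P`, for a generator `x`. -/
def sideOf {g : ℕ} (x : Gen g) : ZMod (4 * g) := if x.2 then idx x.1 3 else idx x.1 0

/-- The identifications of corners `(h, k)` (corner number `k` of the tile `hP`) that result from
gluing each tile `hP` with `h a_i P` and `h b_i P` along their common sides. -/
inductive CornerGlue (g : ℕ) :
    SurfaceGroup g × ZMod (4 * g) → SurfaceGroup g × ZMod (4 * g) → Prop
  | a_fst (h : SurfaceGroup g) (i : Fin g) :
      CornerGlue g (h * gen (i, false), idx i 3) (h, idx i 0)
  | a_snd (h : SurfaceGroup g) (i : Fin g) :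
      CornerGlue g (h * gen (i, false), idx i 2) (h, idx i 1)
  | b_fst (h : SurfaceGroup g) (i : Fin g) :
      CornerGlue g (h * gen (i, true), idx i 2) (h, idx i 3)
  | b_snd (h : SurfaceGroup g) (i : Fin g) :
      CornerGlue g (h * gen (i, true), idx i 1) (h, idx i 4)

/-- The vertices of the abstract tessellation, that is, of the cell complex obtained from the
disjoint union of the `4g`-gons `hP` by gluing them along their common sides. -/
def AbstractVertex (g : ℕ) : Type := Quot (CornerGlue g)

/-- Corner number `k` of the tile `hP` in the abstract tessellation. -/
def abstractCorner (g : ℕ) (h : SurfaceGroup g) (k : ZMod (4 * g)) : AbstractVertex g :=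
  Quot.mk _ (h, k)

/-- The geodesic segment between two points of the hyperbolic plane. -/
def geodesicSegment (z w : UpperHalfPlane) : Set UpperHalfPlane :=
  {x | dist z x + dist x w = dist z w}

/-- A canonical tessellation of the hyperbolic plane corresponding to the surface group: the group
acts freely by orientation-preserving isometries, and the images of a hyperbolic `4g`-gon `P` tile
the plane; the sides of `P` are paired by the canonical generators. -/
structure CanonicalTessellation (g : ℕ) where
  /-- the action of the group on the hyperbolic plane -/
  ρ : SurfaceGroup g →* (UpperHalfPlane ≃ᵢ UpperHalfPlane)
  orientation_preserving : ∀ h, ∃ A : Matrix.SpecialLinearGroup (Fin 2) ℝ,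
    ∀ z : UpperHalfPlane, ρ h z = A • z
  free : ∀ (h : SurfaceGroup g) (z : UpperHalfPlane), ρ h z = z → h = 1
  /-- the corners of the polygon, in cyclic order -/
  corner : ZMod (4 * g) → UpperHalfPlane
  corner_injective : Function.Injective corner
  /-- the boundary of the polygon does not intersect itself -/
  sides_simple : ∀ j k, j ≠ k →
    geodesicSegment (corner j) (corner (j + 1)) ∩ geodesicSegment (corner k) (corner (k + 1)) ⊆
      {corner j, corner (j + 1)} ∩ {corner k, corner (k + 1)}
  /-- the polygon -/
  P : Set UpperHalfPlane
  isCompact_P : IsCompact P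
  interior_nonempty : (interior P).Nonempty
  frontier_P : frontier P = ⋃ k, geodesicSegment (corner k) (corner (k + 1))
  /-- the translates of the polygon cover the plane and do not overlap -/
  cover : ⋃ h, ρ h '' P = Set.univ
  disjoint : ∀ h h', h ≠ h' → Disjoint (ρ h '' interior P) (ρ h' '' interior P)
  /-- `a_i` maps the side number `4i + 2` onto the side number `4i` -/
  pair_a : ∀ i : Fin g, ρ (gen (i, false)) (corner (idx i 3)) = corner (idx i 0) ∧
    ρ (gen (i, false)) (corner (idx i 2)) = corner (idx i 1)
  /-- `b_i` maps the side number `4i + 1` onto the side number `4i + 3` -/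
  pair_b : ∀ i : Fin g, ρ (gen (i, true)) (corner (idx i 2)) = corner (idx i 3) ∧
    ρ (gen (i, true)) (corner (idx i 1)) = corner (idx i 4)

/-- Corner number `k` of the tile `hP`, as a point of the hyperbolic plane. -/
def CanonicalTessellation.tileCorner {g : ℕ} (T : CanonicalTessellation g)
    (h : SurfaceGroup g) (k : ZMod (4 * g)) : UpperHalfPlane :=
  T.ρ h (T.corner k)

/-- The set of vertices of a tessellation, `pt h k` being the corner number `k` of the tile `hP`. -/
def vertexSet {g : ℕ} {X : Type} (pt : SurfaceGroup g → ZMod (4 * g) → X) : Set X :=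
  {v | ∃ h k, pt h k = v}

/-- `w` is a loop in the Cayley graph around the vertex `v` of the tessellation: a cycle whose
vertices are exactly the tiles that have `v` as a vertex, in their cyclic order, that is, each edge
of `w` crosses a side (common to two consecutive tiles) of which `v` is an endpoint. The edge
`(h, x)` of the Cayley graph crosses the common side of `hP` and `h x P`. -/
def IsLoopAround {g : ℕ} {X : Type} (pt : SurfaceGroup g → ZMod (4 * g) → X) (v : X)
    (w : List ((SurfaceGroup g × Gen g) × Bool)) : Prop :=
  (cayley gen).IsCycle w ∧
  (∀ h, h ∈ w.map (cayley gen).src ↔ ∃ k, pt h k = v) ∧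
  ∀ p ∈ w, v = pt p.1.1 (sideOf p.1.2) ∨ v = pt p.1.1 (sideOf p.1.2 + 1)

/-- Each vertex `v` of the tessellation has a loop around it, and, whatever starting points and
directions of these loops are chosen, their chains `γ_v` form a Riesz basis in `ℓ²_{0,c}(E)`. -/
def VertexCyclesFormRieszBasis {g : ℕ} {X : Type} (pt : SurfaceGroup g → ZMod (4 * g) → X) : Prop :=
  (∀ v ∈ vertexSet pt, ∃ w, IsLoopAround pt v w) ∧
  ∀ w : vertexSet pt → List ((SurfaceGroup g × Gen g) × Bool),
    (∀ v : vertexSet pt, IsLoopAround pt (v : X) (w v)) →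
    ∃ γ : vertexSet pt → (cayley (gen (g := g))).l2c,
      (∀ v e, (γ v : lp (fun _ : SurfaceGroup g × Gen g => ℝ) 2) e =
        OrientedGraph.walkChain (w v) e) ∧
      IsRieszBasis γ

end CoexactGap

end

noncomputable section

namespace CoexactGap

/-! Every vertex of the tessellation is corner 0 of exactly one tile `mP`, and the tiles around it
are `m` times the partial products of the relator. Up to sign, the loops around vertices are
therefore the relator loops based at the elements `m` of `Γ`. The central object is `B = boundaryOp
g`, with `B α = ∑ α_m γ_m`; its adjoint integrates a 1-cochain along all relator loops.

Two facts carry part 1. First, `B` is bounded below (`norm_sq_le_boundaryOp`): the coefficient of `B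
α` at an edge is a difference of two values of `α`, so `‖B α‖` dominates a discrete gradient. Since
`Γ` maps onto the free group of rank 2, that gradient dominates `‖α‖` by Kesten's inequality, proved
with an explicit flow (`sum_sq_le_of_hom_freeGroup`). Second, the kernel of `B*` consists of
coboundaries (`exists_potential`), because the relator presents `Γ`. The potential need not be
square-summable, yet the coboundary is orthogonal to finite cycles and hence to their closure. The
first fact gives the Riesz inequalities, the second completeness. The geometric and the abstract
tessellation differ only in why corners 0 of different tiles are different: freeness of the action,
or an explicit invariant of the gluing.

For part 2, the Laplacian on `ℓ²_{0,c}` is `d*d`, so the gap amounts to `‖f‖ ≤ C ‖df‖`. Writing each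
system of generators in the other gives operators `P` and `Q` between the two edge spaces. The
difference `f - QPf` consists of integrals along closed words. In `⟨f, QPf⟩ = ⟨Q*f, Pf⟩` the vector
`Q*f` is orthogonal to coboundaries, so it equals `B α` with `‖α‖` controlled by `‖f‖`, and `B*Pf`
again consists of integrals along a closed word. In a simply connected complex such integrals are
bounded by `‖df‖` (`exists_norm_pathOp_le`), since the word contracts in finitely many steps, the
same from every starting point. Simple connectedness for large `D` holds because `Γ` is finitely
presented (`exists_isSimplyConnected`). -/

/-- The real Hilbert space of square-summable functions on `X`. -/
abbrev L2 (X : Type*) : Type _ := lp (fun _ : X => ℝ) 2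

theorem memℓp_two_iff {X : Type*} (f : X → ℝ) :
    Memℓp f 2 ↔ Summable fun x => f x ^ 2 := by
  rw [memℓp_gen_iff (by norm_num)]
  simp

/-! ### Square-summable functions: coordinates, injections, finite stacking -/

namespace L2

variable {X Y J H : Type*}

theorem summable_sq (f : L2 X) : Summable fun x => f x ^ 2 :=
  (memℓp_two_iff _).1 f.2

theorem norm_sq (f : L2 X) : ‖f‖ ^ 2 = ∑' x, f x ^ 2 := by
  have h := lp.norm_rpow_eq_tsum (p := 2) (by norm_num) f
  simpa using h

theorem inner_eq (f g : L2 X) : inner ℝ f g = ∑' x, f x * g x := by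
  rw [lp.inner_eq_tsum]
  exact tsum_congr fun x => by simp [mul_comm]

open Classical in
/-- The unit vector at `x`. -/
def delta (x : X) : L2 X := lp.single 2 x (1 : ℝ)

open Classical in
theorem delta_apply (x y : X) : (delta x) y = if y = x then 1 else 0 := by
  rw [delta, lp.single_apply, Pi.single_apply]

open Classical in
theorem inner_delta_left (x : X) (f : L2 X) : inner ℝ (delta x) f = f x := by
  rw [delta, lp.inner_single_left]
  simp

theorem inner_delta_right (x : X) (f : L2 X) : inner ℝ f (delta x) = f x := by
  rw [real_inner_comm, inner_delta_left]

theorem hasSum_delta (f : L2 X) : HasSum (fun x => f x • delta x) f := by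
  classical
  refine (lp.hasSum_single (by norm_num) f).congr_fun ?_
  intro x
  ext y
  rw [lp.coeFn_smul, Pi.smul_apply, delta_apply, lp.single_apply, Pi.single_apply]
  aesop

theorem tsum_comp_le_of_injective {j : X → Y} (hj : Function.Injective j) (v : L2 Y) :
    ∑' x, v (j x) ^ 2 ≤ ‖v‖ ^ 2 := by
  rw [norm_sq]
  exact tsum_comp_le_tsum_of_inj (summable_sq v) (fun _ => sq_nonneg _) hj

theorem summable_comp {j : X → Y} (hj : Function.Injective j) (v : L2 Y) :
    Summable fun x => v (j x) ^ 2 :=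
  (summable_sq v).comp_injective hj

/-- A function dominated by a square-summable function along an injection has smaller norm. -/
theorem norm_le_of_abs_le {j : X → Y} (hj : Function.Injective j) (u : L2 X) (v : L2 Y)
    (h : ∀ x, |u x| ≤ |v (j x)|) : ‖u‖ ≤ ‖v‖ := by
  have h1 : ‖u‖ ^ 2 ≤ ‖v‖ ^ 2 := by
    refine le_trans ?_ (tsum_comp_le_of_injective hj v)
    rw [norm_sq]
    exact (summable_sq u).tsum_le_tsum (fun x => sq_le_sq.2 (h x)) (summable_comp hj v)
  exact (sq_le_sq₀ (norm_nonneg _) (norm_nonneg _)).1 h1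

/-- Composition with an injection. -/
def comp (j : X → Y) (hj : Function.Injective j) : L2 Y →L[ℝ] L2 X :=
  LinearMap.mkContinuous
    { toFun := fun f => ⟨fun x => f (j x), (memℓp_two_iff _).2 (summable_comp hj f)⟩
      map_add' := fun f g => by ext x; simp; rfl
      map_smul' := fun c f => by ext x; simp } 1 (fun f => by
        rw [one_mul]
        exact norm_le_of_abs_le hj _ _ fun x => le_rfl)

@[simp]
theorem comp_apply (j : X → Y) (hj : Function.Injective j) (f : L2 Y) (x : X) :
    comp j hj f x = f (j x) := rfl

theorem norm_comp_le (j : X → Y) (hj : Function.Injective j) (f : L2 Y) : ‖comp j hj f‖ ≤ ‖f‖ :=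
  norm_le_of_abs_le hj _ _ fun _ => le_rfl

section Stack

variable [Fintype J]

theorem hasSum_stack (v : J → L2 X) :
    HasSum (fun p : X × J => v p.2 p.1 ^ 2) (∑ j, ‖v j‖ ^ 2) := by
  have h1 : ∀ p : X × J, 0 ≤ v p.2 p.1 ^ 2 := fun p => sq_nonneg _
  have hs : Summable fun p : X × J => v p.2 p.1 ^ 2 := by
    rw [← (Equiv.prodComm J X).summable_iff]
    refine (summable_prod_of_nonneg fun p => sq_nonneg _).2 ⟨fun j => ?_, ?_⟩
    · exact summable_sq (v j)
    · exact (hasSum_fintype _).summable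
  have h2 : ∑' p : X × J, v p.2 p.1 ^ 2 = ∑ j, ‖v j‖ ^ 2 := by
    rw [← (Equiv.prodComm J X).tsum_eq]
    have := (((Equiv.prodComm J X).summable_iff).2 hs).tsum_prod
    simp only [Function.comp_apply, Equiv.prodComm_apply, Prod.snd_swap, Prod.fst_swap] at this ⊢
    rw [this, tsum_fintype]
    simp only [norm_sq]
  rw [← h2]
  exact hs.hasSum

variable [NormedAddCommGroup H] [InnerProductSpace ℝ H]

/-- Finitely many operators into `L2 X` as one operator into `L2 (X × J)`. -/
def stack (T : J → H →L[ℝ] L2 X) : H →L[ℝ] L2 (X × J) :=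
  LinearMap.mkContinuous
    { toFun := fun f => ⟨fun p => T p.2 f p.1,
        (memℓp_two_iff _).2 (hasSum_stack fun j => T j f).summable⟩
      map_add' := fun f g => by ext x; simp; rfl
      map_smul' := fun c f => by ext x; simp } (∑ j, ‖T j‖) (fun f => by
        have h0 : 0 ≤ ∑ j, ‖T j‖ := Finset.sum_nonneg fun j _ => norm_nonneg _
        refine (sq_le_sq₀ (norm_nonneg _) (mul_nonneg h0 (norm_nonneg _))).1 ?_
        rw [norm_sq]
        refine le_trans (le_of_eq (hasSum_stack fun j => T j f).tsum_eq) ?_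
        rw [mul_pow]
        have h1 : ∑ j, ‖T j f‖ ^ 2 ≤ (∑ j, ‖T j f‖) ^ 2 :=
          Finset.sum_sq_le_sq_sum_of_nonneg fun j _ => norm_nonneg _
        refine h1.trans ?_
        rw [← mul_pow, Finset.sum_mul]
        gcongr with j
        exact (T j).le_opNorm f)

@[simp]
theorem stack_apply (T : J → H →L[ℝ] L2 X) (f : H) (p : X × J) :
    stack T f p = T p.2 f p.1 := rfl

theorem norm_stack_sq (T : J → H →L[ℝ] L2 X) (f : H) :
    ‖stack T f‖ ^ 2 = ∑ j, ‖T j f‖ ^ 2 := by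
  rw [norm_sq]
  exact (hasSum_stack fun j => T j f).tsum_eq

theorem norm_stack_le (T : J → H →L[ℝ] L2 X) (f : H) :
    ‖stack T f‖ ≤ ∑ j, ‖T j f‖ := by
  refine (sq_le_sq₀ (norm_nonneg _) (Finset.sum_nonneg fun j _ => norm_nonneg _)).1 ?_
  rw [norm_stack_sq]
  exact Finset.sum_sq_le_sq_sum_of_nonneg fun j _ => norm_nonneg _

end Stack

end L2

/-! ### Integrals, chains and homotopies of paths in a graph -/

/-- The integral of a 1-cochain along a path. -/
def integral {E : Type*} (f : E → ℝ) (l : List (E × Bool)) : ℝ :=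
  (l.map fun p => if p.2 then f p.1 else -f p.1).sum

section Integral

variable {E : Type*}

@[simp]
theorem integral_nil (f : E → ℝ) : integral f [] = 0 := rfl

theorem integral_cons (f : E → ℝ) (d : E × Bool) (l : List (E × Bool)) :
    integral f (d :: l) = (if d.2 then f d.1 else -f d.1) + integral f l := by
  simp [integral]

theorem integral_append (f : E → ℝ) (l l' : List (E × Bool)) :
    integral f (l ++ l') = integral f l + integral f l' := by
  simp [integral]

end Integral

namespace OrientedGraph

variable {V E : Type*} (G : OrientedGraph V E)

open Classical in
theorem walkChain_cons (d : E × Bool) (l : List (E × Bool)) (e : E) :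
    walkChain (d :: l) e =
      (if d.1 = e then if d.2 then (1 : ℝ) else -1 else 0) + walkChain l e := by
  obtain ⟨d, b⟩ := d
  simp only [walkChain, List.count_cons]
  cases b <;> by_cases h : d = e <;> simp [h] <;> ring

-- This is the link that later makes the chain of a path the adjoint of integration along it.
open Classical in
theorem walkChain_eq_integral (l : List (E × Bool)) (e : E) :
    walkChain l e = integral (fun x => if x = e then 1 else 0) l := by
  induction l with
  | nil => simp [walkChain]
  | cons d l ih =>
    rw [walkChain_cons, integral_cons, ih]
    split_ifs <;> simp

theorem walkChain_eq_zero {l : List (E × Bool)} {e : E} (h : e ∉ l.map Prod.fst) :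
    walkChain l e = 0 := by
  induction l with
  | nil => simp [walkChain]
  | cons d l ih =>
    simp only [List.map_cons, List.mem_cons, not_or] at h
    rw [walkChain_cons, ih h.2, if_neg (Ne.symm h.1), add_zero]

theorem walkChain_of_mem {l : List (E × Bool)} (hl : (l.map Prod.fst).Nodup) {d : E × Bool}
    (hd : d ∈ l) : walkChain l d.1 = if d.2 then 1 else -1 := by
  induction l with
  | nil => simp at hd
  | cons c l ih =>
    rw [List.map_cons, List.nodup_cons] at hl
    rw [walkChain_cons]
    rcases List.mem_cons.1 hd with rfl | hd
    · rw [walkChain_eq_zero hl.1, if_pos rfl, add_zero]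
    · rw [ih hl.2 hd, if_neg, zero_add]
      intro h
      exact hl.1 (h ▸ List.mem_map_of_mem hd)

theorem integral_eq_sum_walkChain (f : E → ℝ) (l : List (E × Bool)) (S : Finset E)
    (hS : ∀ e ∈ l.map Prod.fst, e ∈ S) :
    integral f l = ∑ e ∈ S, f e * walkChain l e := by
  classical
  induction l with
  | nil => simp [walkChain]
  | cons d l ih =>
    have hd : d.1 ∈ S := hS _ (by simp)
    rw [integral_cons, ih fun e he => hS e (by
      rw [List.map_cons]; exact List.mem_cons_of_mem _ he)]
    simp only [walkChain_cons, mul_add, Finset.sum_add_distrib]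
    congr 1
    simp [Finset.sum_ite_eq, hd]

theorem isWalk_append {u v : V} {p q : List (E × Bool)} :
    G.IsWalk u (p ++ q) v ↔ ∃ x, G.IsWalk u p x ∧ G.IsWalk x q v := by
  induction p generalizing u with
  | nil => simp [IsWalk]
  | cons d p ih =>
    simp only [List.cons_append, IsWalk, ih]
    aesop

theorem integral_d0 (φ : V → ℝ) {u v : V} {l : List (E × Bool)} (h : G.IsWalk u l v) :
    integral (G.d0 φ) l = φ v - φ u := by
  induction l generalizing u with
  | nil => cases h; simp
  | cons d l ih =>
    obtain ⟨rfl, h⟩ := h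
    rw [integral_cons, ih h]
    simp only [d0, src, tgt]
    split_ifs <;> ring

theorem IsWalk.tgt_getElem {u v : V} {l : List (E × Bool)} (h : G.IsWalk u l v) (k : ℕ)
    (hk : k + 1 < l.length) : G.tgt l[k] = G.src l[k + 1] := by
  induction l generalizing u k with
  | nil => simp at hk
  | cons d l ih =>
    obtain ⟨-, h⟩ := h
    cases k with
    | zero =>
      cases l with
      | nil => simp at hk
      | cons d' l => exact h.1.symm
    | succ k => exact ih h k (by simpa using hk)

theorem IsWalk.tgt_last {u v : V} {l : List (E × Bool)} (h : G.IsWalk u l v) (k : ℕ)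
    (hk : k + 1 = l.length) : G.tgt (l[k]'(by omega)) = v := by
  induction l generalizing u k with
  | nil => simp at hk
  | cons d l ih =>
    obtain ⟨-, h⟩ := h
    cases k with
    | zero =>
      have : l = [] := by simpa using hk
      subst this
      exact h
    | succ k => exact ih h k (by simpa using hk)

theorem IsWalk.src_head {u v : V} {l : List (E × Bool)} (h : G.IsWalk u l v)
    (hl : 0 < l.length) : G.src l[0] = u := by
  cases l with
  | nil => simp at hl
  | cons d l => exact h.1

/-- A 1-chain without boundary supported in a cycle is constant along the cycle. -/
theorem constant_along_cycle {w : List (E × Bool)} (hw : G.IsCycle w) (g : Fin w.length → ℝ)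
    (hg : ∀ φ : V → ℝ, ∑ k, g k * (φ (G.tgt w[k]) - φ (G.src w[k])) = 0) (k l : Fin w.length) :
    g k = g l := by
  classical
  obtain ⟨-, ⟨u, hu⟩, hsrc, -⟩ := hw
  have inj : ∀ i j : Fin w.length, G.src w[i] = G.src w[j] → i = j := by
    intro i j hij
    have h := (List.nodup_iff_injective_getElem (l := w.map G.src)).1 hsrc
    have h2 := @h ⟨i, by simp⟩ ⟨j, by simp⟩ (by simpa using hij)
    simpa [Fin.ext_iff] using h2
  have step : ∀ k (hk : k + 1 < w.length), g ⟨k + 1, hk⟩ = g ⟨k, by omega⟩ := by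
    intro k hk
    have h := hg fun x => if x = G.src w[k + 1] then 1 else 0
    simp only [mul_sub, Finset.sum_sub_distrib, mul_ite, mul_one, mul_zero] at h
    have e1 : ∀ j : Fin w.length, (G.tgt w[j] = G.src w[k + 1]) ↔ j = ⟨k, by omega⟩ := by
      intro j
      constructor
      · intro hj
        rcases lt_or_eq_of_le (Nat.succ_le_of_lt j.2) with h1 | h1
        · have h2 := hu.tgt_getElem G j h1
          have h3 := inj ⟨j + 1, h1⟩ ⟨k + 1, hk⟩ (by
            rw [← Fin.getElem_fin] at *; exact h2.symm.trans hj)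
          simpa [Fin.ext_iff] using h3
        -- The last passage ends at the source of passage 0, which is never passage `k + 1`.
        · have h2 := hu.tgt_last G j h1
          have h3 := inj ⟨0, by omega⟩ ⟨k + 1, hk⟩
            ((hu.src_head G (by omega)).trans (h2.symm.trans hj))
          simp at h3
      · rintro rfl
        exact hu.tgt_getElem G k hk
    have e2 : ∀ j : Fin w.length, (G.src w[j] = G.src w[k + 1]) ↔ j = ⟨k + 1, hk⟩ :=
      fun j => ⟨fun hj => inj j ⟨k + 1, hk⟩ hj, by rintro rfl; rfl⟩
    simp only [e1, e2, Finset.sum_ite_eq', Finset.mem_univ, if_true] at h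
    linarith
  have h0 : ∀ k (hk : k < w.length), g ⟨k, hk⟩ = g ⟨0, by omega⟩ := by
    intro k
    induction k with
    | zero => intro _; rfl
    | succ k ih => intro hk; rw [step k hk, ih]
  rw [h0 k k.2, h0 l l.2]

/-- Cycles supported in the same cycle have the same chain up to sign. -/
theorem walkChain_eq_or_neg {w w' : List (E × Bool)} (hw : G.IsCycle w) (hw' : G.IsCycle w')
    (h : ∀ e ∈ w'.map Prod.fst, e ∈ w.map Prod.fst) :
    ∃ κ : ℝ, (κ = 1 ∨ κ = -1) ∧ ∀ e, walkChain w' e = κ * walkChain w e := by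
  classical
  have hn := hw.2.2.2
  -- The coefficients of `w'` along `w`, measured relative to the directions in which `w` passes its
  -- edges.
  set g : Fin w.length → ℝ := fun k =>
    if w[k].2 then walkChain w' w[k].1 else -walkChain w' w[k].1 with hgdef
  have hg : ∀ φ : V → ℝ, ∑ k, g k * (φ (G.tgt w[k]) - φ (G.src w[k])) = 0 := by
    intro φ
    obtain ⟨-, ⟨u, hu⟩, -, -⟩ := hw'
    have h1 := G.integral_d0 φ hu
    rw [sub_self, integral_eq_sum_walkChain _ _ (w.map Prod.fst).toFinset (by
      intro e he; exact List.mem_toFinset.2 (h e he)), List.sum_toFinset _ hn,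
      List.map_map, ← Fin.sum_univ_fun_getElem] at h1
    rw [← h1]
    refine Finset.sum_congr rfl fun k _ => ?_
    simp only [hgdef, Function.comp, d0, src, tgt, Fin.getElem_fin]
    split_ifs <;> ring
  -- The constant is read off at one edge of `w'`; it is a sign because `w'` passes that edge
  -- exactly once.
  obtain ⟨d', hd'⟩ := List.exists_mem_of_ne_nil _ hw'.1
  obtain ⟨d, hd, hdd⟩ := List.mem_map.1 (h d'.1 (List.mem_map_of_mem hd'))
  obtain ⟨k, hk, rfl⟩ := List.mem_iff_getElem.1 hd
  have hdv := walkChain_of_mem hw'.2.2.2 hd'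
  refine ⟨g ⟨k, hk⟩, ?_, fun e => ?_⟩
  · simp only [hgdef, Fin.getElem_fin, hdd, hdv]
    split_ifs <;> simp
  · by_cases he : e ∈ w.map Prod.fst
    · obtain ⟨c, hc, rfl⟩ := List.mem_map.1 he
      rw [walkChain_of_mem hn hc]
      obtain ⟨j, hj, rfl⟩ := List.mem_iff_getElem.1 hc
      rw [G.constant_along_cycle hw g hg ⟨k, hk⟩ ⟨j, hj⟩]
      simp only [hgdef, Fin.getElem_fin]
      split_ifs <;> simp
    · rw [walkChain_eq_zero he, mul_zero, walkChain_eq_zero fun h' => he (h e h')]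

theorem exists_split_of_not_nodup {α β : Type*} (f : α → β) {l : List α}
    (h : ¬ (l.map f).Nodup) :
    ∃ p a m b q, l = p ++ a :: m ++ b :: q ∧ f a = f b := by
  induction l with
  | nil => simp at h
  | cons c l ih =>
    rw [List.map_cons, List.nodup_cons, not_and_or, not_not] at h
    rcases h with h | h
    · obtain ⟨b, hb, hcb⟩ := List.mem_map.1 h
      obtain ⟨m, q, rfl⟩ := List.append_of_mem hb
      exact ⟨[], c, m, b, q, by simp, hcb.symm⟩
    · obtain ⟨p, a, m, b, q, rfl, hab⟩ := ih h
      exact ⟨c :: p, a, m, b, q, by simp, hab⟩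

variable {G}

theorem HomotopyStep.append {D : ℕ} {u v u' v' : V} {l l' p q : List (E × Bool)}
    (h : G.HomotopyStep D u v l l') (hp : G.IsWalk u' p u) (hq : G.IsWalk v q v') :
    G.HomotopyStep D u' v' (p ++ l ++ q) (p ++ l' ++ q) := by
  have key : ∀ l, G.IsWalk u l v → G.IsWalk u' (p ++ l ++ q) v' := fun l hl =>
    G.isWalk_append.2 ⟨v, G.isWalk_append.2 ⟨u, hp, hl⟩, hq⟩
  cases h with
  | backtrack p' q' e b hw =>
    have := HomotopyStep.backtrack (G := G) (D := D) (u := u') (v := v') (p ++ p') (q' ++ q) e b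
      (by simpa using key _ hw)
    simpa using this
  | face p' w q' hw hc hl =>
    have := HomotopyStep.face (G := G) (D := D) (u := u') (v := v') (p ++ p') w (q' ++ q)
      (by simpa using key _ hw) hc hl
    simpa using this

theorem homotopic_append {D : ℕ} {u v u' v' : V} {l l' p q : List (E × Bool)}
    (h : Relation.EqvGen (G.HomotopyStep D u v) l l') (hp : G.IsWalk u' p u)
    (hq : G.IsWalk v q v') :
    Relation.EqvGen (G.HomotopyStep D u' v') (p ++ l ++ q) (p ++ l' ++ q) := by
  induction h with
  | rel _ _ h => exact .rel _ _ (h.append hp hq)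
  | refl => exact .refl _
  | symm _ _ _ ih => exact .symm _ _ ih
  | trans _ _ _ _ _ ih1 ih2 => exact .trans _ _ _ ih1 ih2

/-- A closed path of length at most `D` is null-homotopic. -/
theorem nullhomotopic_of_length_le {D : ℕ} {u : V} {l : List (E × Bool)} (h : G.IsWalk u l u)
    (hl : l.length ≤ D) : Relation.EqvGen (G.HomotopyStep D u u) l [] := by
  induction hn : l.length using Nat.strong_induction_on generalizing u l with
  | _ n ih =>
  by_cases h0 : l = []
  · subst h0; exact .refl _
  by_cases hs : (l.map G.src).Nodup
  · by_cases hf : (l.map Prod.fst).Nodup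
    · exact .rel _ _ (by
        simpa using HomotopyStep.face (G := G) (D := D) (u := u) (v := u) [] l [] (by simpa using h)
          ⟨h0, ⟨u, h⟩, hs, hf⟩ hl)
    -- An edge is repeated but no source is. The two passages must be opposite, since equal ones
    -- share their source, and adjacent, since otherwise the vertex reached by the first would be a
    -- source twice. So they form a backtracking.
    · obtain ⟨p, a, m, b, q, rfl, hab⟩ := exists_split_of_not_nodup _ hf
      obtain ⟨e, s⟩ := a
      obtain ⟨e', s'⟩ := b
      obtain rfl : e = e' := hab
      have hss : s' = !s := by
        by_contra hne
        have : s' = s := by cases s <;> cases s' <;> simp_all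
        subst this
        rw [List.map_append, List.map_append, List.map_cons, List.map_cons] at hs
        have := List.nodup_append.1 hs
        exact this.2.2 _ (by simp) _ (List.mem_cons_self) rfl
      subst hss
      have hm : m = [] := by
        by_contra hm
        obtain ⟨c, m', rfl⟩ := List.exists_cons_of_ne_nil hm
        obtain ⟨x, h1, h2⟩ := G.isWalk_append.1 h
        obtain ⟨y, -, h3⟩ := G.isWalk_append.1 h1
        have hc : G.src c = G.src (e, !s) := by
          have e1 : G.src c = G.tgt (e, s) := h3.2.1
          rw [e1]
          cases s <;> simp [src, tgt]
        rw [List.map_append, List.map_append, List.map_cons, List.map_cons] at hs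
        have := List.nodup_append.1 hs
        exact this.2.2 _ (by simp) _ (List.mem_cons_self) hc
      subst hm
      have hw : G.IsWalk u (p ++ [(e, s), (e, !s)] ++ q) u := by simpa using h
      have hst := HomotopyStep.backtrack (G := G) (D := D) p q e s hw
      have hpq : G.IsWalk u (p ++ q) u := by
        obtain ⟨x, h1, h2⟩ := G.isWalk_append.1 hw
        obtain ⟨y, h3, h4⟩ := G.isWalk_append.1 h1
        have : y = x := by
          obtain ⟨rfl, -, h4⟩ := h4
          rw [← (show G.tgt (e, !s) = x from h4)]
          cases s <;> simp [src, tgt]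
        subst this
        exact G.isWalk_append.2 ⟨_, h3, h2⟩
      have := ih (p ++ q).length (by subst hn; simp) hpq (by simp at hl ⊢; omega) rfl
      refine .trans _ _ _ (.rel _ _ ?_) this
      simpa using hst
  -- At a repeated vertex the path splits into two shorter closed paths, contracted one after the
  -- other.
  · obtain ⟨p, a, m, b, q, rfl, hab⟩ := exists_split_of_not_nodup _ hs
    obtain ⟨x, h1, h2⟩ := G.isWalk_append.1 h
    obtain ⟨y, h3, h4⟩ := G.isWalk_append.1 h1
    have hxy : x = y := by rw [← h2.1, ← h4.1, hab]
    subst hxy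
    have i1 := ih (a :: m).length (by subst hn; simp; omega) h4 (by simp at hl ⊢; omega) rfl
    have i2 := ih (p ++ b :: q).length (by subst hn; simp)
      (G.isWalk_append.2 ⟨_, h3, h2⟩) (by simp at hl ⊢; omega) rfl
    refine .trans _ _ _ (homotopic_append i1 h3 h2) ?_
    simpa using i2

end OrientedGraph

/-! ### Words and paths in Cayley graphs -/

section Paths

variable {Γ ι : Type*} [Group Γ] (s : ι → Γ)

/-- The group element of a letter. -/
def letterVal (x : ι × Bool) : Γ := if x.2 then s x.1 else (s x.1)⁻¹

/-- The group element of a word. -/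
def wordVal (w : List (ι × Bool)) : Γ := (w.map (letterVal s)).prod

/-- The passage from `h` to `h * letterVal s x` in the Cayley graph. -/
def dart (h : Γ) (x : ι × Bool) : (Γ × ι) × Bool :=
  ((if x.2 then h else h * (s x.1)⁻¹, x.1), x.2)

/-- The path in the Cayley graph that starts at `h` and spells the word `w`. -/
def path : Γ → List (ι × Bool) → List ((Γ × ι) × Bool)
  | _, [] => []
  | h, x :: w => dart s h x :: path (h * letterVal s x) w

/-- The word spelled by a path in the Cayley graph. -/
def spell (l : List ((Γ × ι) × Bool)) : List (ι × Bool) := l.map fun d => (d.1.2, d.2)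

@[simp] theorem wordVal_nil : wordVal s [] = 1 := rfl

@[simp] theorem wordVal_cons (x : ι × Bool) (w : List (ι × Bool)) :
    wordVal s (x :: w) = letterVal s x * wordVal s w := by simp [wordVal]

@[simp] theorem wordVal_append (w w' : List (ι × Bool)) :
    wordVal s (w ++ w') = wordVal s w * wordVal s w' := by simp [wordVal]

theorem wordVal_eq_lift (w : List (ι × Bool)) :
    wordVal s w = FreeGroup.lift s (FreeGroup.mk w) := by
  rw [FreeGroup.lift_mk, wordVal]
  congr 1
  refine List.map_congr_left fun x _ => ?_
  cases h : x.2 <;> simp [letterVal, h]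

@[simp] theorem path_nil (h : Γ) : path s h [] = [] := rfl

theorem path_cons (h : Γ) (x : ι × Bool) (w : List (ι × Bool)) :
    path s h (x :: w) = dart s h x :: path s (h * letterVal s x) w := rfl

theorem path_append (h : Γ) (w w' : List (ι × Bool)) :
    path s h (w ++ w') = path s h w ++ path s (h * wordVal s w) w' := by
  induction w generalizing h with
  | nil => simp
  | cons x w ih => simp [path_cons, ih, mul_assoc]

@[simp] theorem src_dart (h : Γ) (x : ι × Bool) : (cayley s).src (dart s h x) = h := by
  obtain ⟨i, b⟩ := x
  cases b <;> simp [OrientedGraph.src, dart, cayley]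

@[simp] theorem tgt_dart (h : Γ) (x : ι × Bool) :
    (cayley s).tgt (dart s h x) = h * letterVal s x := by
  obtain ⟨i, b⟩ := x
  cases b <;> simp [OrientedGraph.tgt, dart, cayley, letterVal]

theorem eq_dart (d : (Γ × ι) × Bool) : d = dart s ((cayley s).src d) (d.1.2, d.2) := by
  obtain ⟨⟨h, i⟩, b⟩ := d
  cases b <;> simp [OrientedGraph.src, dart, cayley]

theorem isWalk_path (h : Γ) (w : List (ι × Bool)) :
    (cayley s).IsWalk h (path s h w) (h * wordVal s w) := by
  induction w generalizing h with
  | nil => simp [OrientedGraph.IsWalk]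
  | cons x w ih =>
    refine ⟨src_dart s h x, ?_⟩
    rw [tgt_dart, wordVal_cons, ← mul_assoc]
    exact ih _

theorem eq_path_of_isWalk {u v : Γ} {l : List ((Γ × ι) × Bool)}
    (h : (cayley s).IsWalk u l v) : l = path s u (spell l) ∧ v = u * wordVal s (spell l) := by
  induction l generalizing u with
  | nil => cases h; simp [spell]
  | cons d l ih =>
    obtain ⟨rfl, h⟩ := h
    have hd := eq_dart s d
    have h1 : (cayley s).tgt d = (cayley s).src d * letterVal s (d.1.2, d.2) := by
      conv_lhs => rw [hd]
      exact tgt_dart s _ _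
    obtain ⟨h2, h3⟩ := ih h
    have h4 : spell (d :: l) = (d.1.2, d.2) :: spell l := rfl
    rw [h4, path_cons, wordVal_cons, ← hd, ← h1, ← h2, ← mul_assoc, ← h1]
    exact ⟨rfl, h3⟩

@[simp] theorem spell_path (h : Γ) (w : List (ι × Bool)) : spell (path s h w) = w := by
  induction w generalizing h with
  | nil => rfl
  | cons x w ih =>
    rw [path_cons, spell, List.map_cons, ← spell, ih]
    rfl

@[simp] theorem length_path (h : Γ) (w : List (ι × Bool)) : (path s h w).length = w.length := by
  conv_rhs => rw [← spell_path s h w, spell, List.length_map]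

@[simp] theorem spell_append {Γ ι : Type*} (l l' : List ((Γ × ι) × Bool)) :
    spell (l ++ l') = spell l ++ spell l' := by simp [spell]

/-- Left translation of passages of edges. -/
def translate (k : Γ) (d : (Γ × ι) × Bool) : (Γ × ι) × Bool := ((k * d.1.1, d.1.2), d.2)

theorem path_mul (k h : Γ) (w : List (ι × Bool)) :
    path s (k * h) w = (path s h w).map (translate k) := by
  induction w generalizing h with
  | nil => rfl
  | cons x w ih =>
    rw [path_cons, path_cons, List.map_cons, mul_assoc, ih]
    congr 1
    obtain ⟨i, b⟩ := x
    cases b <;> simp [translate, dart, mul_assoc]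

theorem isCycle_path_mul (k h : Γ) {w : List (ι × Bool)} (hw : (cayley s).IsCycle (path s h w)) :
    (cayley s).IsCycle (path s (k * h) w) := by
  obtain ⟨h0, ⟨v, hv⟩, hs, hf⟩ := hw
  have hv0 : h = v := by
    cases w with
    | nil => simp at h0
    | cons x w => rw [path_cons] at hv; simpa using hv.1
  subst hv0
  have h1 : wordVal s w = 1 := by
    have := (eq_path_of_isWalk s hv).2
    rw [spell_path] at this
    simpa using this
  refine ⟨?_, ⟨k * h, ?_⟩, ?_, ?_⟩
  · intro h2
    apply h0
    have := congrArg List.length h2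
    rw [length_path] at this
    exact List.length_eq_zero_iff.1 (by rw [length_path]; simpa using this)
  · have := isWalk_path s (k * h) w
    rwa [h1, mul_one] at this
  · rw [path_mul, List.map_map]
    have : (cayley s).src ∘ translate k = (fun x => k * x) ∘ (cayley s).src := by
      funext d
      obtain ⟨⟨h, i⟩, b⟩ := d
      cases b <;> simp [OrientedGraph.src, translate, cayley, mul_assoc]
    rw [this, ← List.map_map]
    exact hs.map (mul_right_injective k)
  · rw [path_mul, List.map_map]
    have : Prod.fst ∘ translate k = (fun e : Γ × ι => (k * e.1, e.2)) ∘ Prod.fst := rfl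
    rw [this, ← List.map_map]
    refine hf.map ?_
    rintro ⟨a, i⟩ ⟨b, j⟩ hab
    simpa using hab

theorem wordVal_invRev (w : List (ι × Bool)) : wordVal s (FreeGroup.invRev w) = (wordVal s w)⁻¹ := by
  rw [wordVal_eq_lift, wordVal_eq_lift, ← FreeGroup.inv_mk, map_inv]

theorem integral_path_letter_inv (f : Γ × ι → ℝ) (h : Γ) (x : ι × Bool) :
    integral f [dart s (h * letterVal s x) (x.1, !x.2)] = -integral f [dart s h x] := by
  obtain ⟨i, b⟩ := x
  cases b <;> simp [integral, dart, letterVal]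

theorem integral_path_cons (f : Γ × ι → ℝ) (h : Γ) (x : ι × Bool) (w : List (ι × Bool)) :
    integral f (path s h (x :: w)) =
      integral f [dart s h x] + integral f (path s (h * letterVal s x) w) := by
  rw [path_cons, ← List.singleton_append, integral_append]

theorem integral_path_invRev (f : Γ × ι → ℝ) (h : Γ) (w : List (ι × Bool)) :
    integral f (path s (h * wordVal s w) (FreeGroup.invRev w)) = -integral f (path s h w) := by
  induction w generalizing h with
  | nil => simp [FreeGroup.invRev]
  | cons x w ih =>
    have h1 : FreeGroup.invRev (x :: w) = FreeGroup.invRev w ++ [(x.1, !x.2)] := by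
      simp [FreeGroup.invRev]
    rw [h1, path_append, integral_append, integral_path_cons s f h x w, wordVal_cons,
      ← mul_assoc, ih, wordVal_invRev, mul_inv_cancel_right, path_cons, path_nil,
      integral_path_letter_inv]
    ring

theorem exists_wordVal_eq (hs : Subgroup.closure (Set.range s) = ⊤) (h : Γ) :
    ∃ w, wordVal s w = h := by
  have h1 : h ∈ (FreeGroup.lift s).range := by
    rw [FreeGroup.range_lift_eq_closure, hs]
    trivial
  obtain ⟨r, rfl⟩ := h1
  induction r using Quot.inductionOn with
  | _ w => exact ⟨w, wordVal_eq_lift s w⟩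

/-- The integrals of a square-summable 1-cochain along the paths that spell `w`, as a
square-summable function of the starting point. -/
def pathOp : List (ι × Bool) → L2 (Γ × ι) →L[ℝ] L2 Γ
  | [] => 0
  | (i, true) :: w =>
      L2.comp (fun h => (h, i)) (fun _ _ h => (Prod.mk.inj h).1) +
        L2.comp (fun h => h * s i) (mul_left_injective _) ∘L pathOp w
  | (i, false) :: w =>
      -L2.comp (fun h => (h * (s i)⁻¹, i))
          (fun _ _ h => mul_left_injective _ (Prod.mk.inj h).1) +
        L2.comp (fun h => h * (s i)⁻¹) (mul_left_injective _) ∘L pathOp w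

theorem pathOp_apply (w : List (ι × Bool)) (f : L2 (Γ × ι)) (h : Γ) :
    pathOp s w f h = integral f (path s h w) := by
  induction w generalizing h with
  | nil => simp [pathOp]
  | cons x w ih =>
    obtain ⟨i, b⟩ := x
    rw [path_cons, integral_cons, ← ih]
    cases b <;> simp [pathOp, dart, letterVal] <;> rfl

/-- Integration along a path is the pairing with its chain, so the adjoint of `pathOp` turns unit
vectors into chains. -/
theorem adjoint_pathOp_delta (w : List (ι × Bool)) (h : Γ) (e : Γ × ι) :
    ContinuousLinearMap.adjoint (pathOp s w) (L2.delta h) e =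
      OrientedGraph.walkChain (path s h w) e := by
  classical
  rw [← L2.inner_delta_right, ContinuousLinearMap.adjoint_inner_left, L2.inner_delta_left,
    pathOp_apply, OrientedGraph.walkChain_eq_integral]
  congr 1
  funext x
  rw [L2.delta_apply]

/-- The 1-cochain `f` integrated along the paths that spell the words `W j`. -/
def substOp {J : Type*} [Fintype J] (W : J → List (ι × Bool)) :
    L2 (Γ × ι) →L[ℝ] L2 (Γ × J) :=
  L2.stack fun j => pathOp s (W j)

theorem substOp_apply {J : Type*} [Fintype J] (W : J → List (ι × Bool)) (f : L2 (Γ × ι))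
    (e : Γ × J) : substOp s W f e = integral f (path s e.1 (W e.2)) := by
  rw [substOp, L2.stack_apply, pathOp_apply]

/-- Substitution of words for letters. -/
def substWord {J : Type*} (W : J → List (ι × Bool)) (r : List (J × Bool)) : List (ι × Bool) :=
  r.flatMap fun x => if x.2 then W x.1 else FreeGroup.invRev (W x.1)

theorem wordVal_substWord {J : Type*} (W : J → List (ι × Bool)) (r : List (J × Bool)) :
    wordVal s (substWord W r) = wordVal (fun j => wordVal s (W j)) r := by
  induction r with
  | nil => rfl
  | cons x r ih =>
    rw [substWord, List.flatMap_cons, ← substWord, wordVal_append, ih, wordVal_cons]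
    obtain ⟨i, b⟩ := x
    cases b <;> simp [letterVal, wordVal_invRev]

/-- A path for one generating system is refined to a path for another by replacing each letter with
a word of the same value; an inverse letter contributes the reversed word, whose integral changes
sign. -/
theorem integral_substOp {J : Type*} [Fintype J] (t : J → Γ) (W : J → List (ι × Bool))
    (hW : ∀ j, wordVal s (W j) = t j) (f : L2 (Γ × ι)) (h : Γ) (r : List (J × Bool)) :
    integral (substOp s W f) (path t h r) = integral f (path s h (substWord W r)) := by
  induction r generalizing h with
  | nil => rfl
  | cons x r ih =>
    rw [substWord, List.flatMap_cons, ← substWord, path_append, integral_append,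
      integral_path_cons, ih]
    obtain ⟨i, b⟩ := x
    cases b
    · have h1 := integral_path_invRev s f (h * (t i)⁻¹) (W i)
      rw [hW, inv_mul_cancel_right] at h1
      simp [integral, dart, letterVal, wordVal_invRev, hW, substOp_apply] at h1 ⊢
      rw [h1]
    · simp [integral, dart, letterVal, hW, substOp_apply]

end Paths

/-! ### Cycles and coboundaries -/

section Cycles

variable {V E : Type*} (G : OrientedGraph V E)

open Classical in
/-- Coboundaries are orthogonal to finite cycles. -/
theorem inner_coboundary_of_mem_finiteCycles {f : L2 E} (hf : f ∈ G.finiteCycles) (φ : V → ℝ)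
    (u : L2 E) (hu : ∀ e, u e = G.d0 φ e) : inner ℝ f u = 0 := by
  obtain ⟨hfin, hbd⟩ := hf
  rw [L2.inner_eq, tsum_eq_sum (s := hfin.toFinset) (by
    intro e he
    have : f e = 0 := by simpa using he
    rw [this, zero_mul])]
  set S := hfin.toFinset
  set T := S.image G.ennd ∪ S.image G.beg
  -- Summation by parts: regroup the edges by an endpoint. All sums are finite because `f` is, which
  -- is why `φ` needs no growth condition.
  have key : ∀ p : E → V, (∀ e ∈ S, p e ∈ T) →
      ∑ e ∈ S, f e * φ (p e) = ∑ v ∈ T, φ v * ∑ᶠ (e : E) (_ : e ∈ {e | p e = v}), f e := by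
    intro p hp
    rw [← Finset.sum_fiberwise_of_maps_to hp]
    refine Finset.sum_congr rfl fun v _ => ?_
    rw [finsum_mem_eq_sum_filter _ _ hfin, Finset.mul_sum]
    refine Finset.sum_congr rfl fun e he => ?_
    rw [(Finset.mem_filter.1 he).2, mul_comm]
  have h1 := key G.ennd fun e he =>
    Finset.mem_union_left _ (Finset.mem_image_of_mem _ he)
  have h2 := key G.beg fun e he =>
    Finset.mem_union_right _ (Finset.mem_image_of_mem _ he)
  simp only [hu, OrientedGraph.d0, mul_sub, Finset.sum_sub_distrib]
  rw [h1, h2, ← Finset.sum_sub_distrib]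
  refine Finset.sum_eq_zero fun v _ => ?_
  rw [← mul_sub]
  have := hbd v
  rw [OrientedGraph.bd1] at this
  rw [this, mul_zero]

/-- Coboundaries are orthogonal to `ℓ²_{0,c}(E)`. -/
theorem inner_coboundary_of_mem_l2c {f : L2 E} (hf : f ∈ G.l2c) (φ : V → ℝ)
    (u : L2 E) (hu : ∀ e, u e = G.d0 φ e) : inner ℝ f u = 0 := by
  -- Only the coboundary `u`, and not `φ`, has to be square-summable for the orthogonality to pass
  -- to the closure.
  have hc : IsClosed {f : L2 E | inner ℝ f u = 0} :=
    isClosed_eq (by fun_prop) continuous_const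
  exact closure_minimal (fun f hf => inner_coboundary_of_mem_finiteCycles G hf φ u hu) hc hf

variable {Γ ι : Type*} [Group Γ] [Fintype ι] (s : ι → Γ)

theorem bd1_cayley (f : Γ × ι → ℝ) (v : Γ) :
    (cayley s).bd1 f v = ∑ i, f (v * (s i)⁻¹, i) - ∑ i, f (v, i) := by
  have h1 : {e : Γ × ι | (cayley s).ennd e = v} = Set.range fun i => (v * (s i)⁻¹, i) := by
    ext ⟨h, i⟩
    simp only [cayley, Set.mem_ofPred_eq, Set.mem_range, Prod.mk.injEq]
    constructor
    · rintro rfl; exact ⟨i, by simp⟩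
    · rintro ⟨j, rfl, rfl⟩; simp
  have h2 : {e : Γ × ι | (cayley s).beg e = v} = Set.range fun i => (v, i) := by
    ext ⟨h, i⟩
    simp only [cayley, Set.mem_ofPred_eq, Set.mem_range, Prod.mk.injEq]
    constructor
    · rintro rfl; exact ⟨i, by simp⟩
    · rintro ⟨j, rfl, rfl⟩; simp
  rw [OrientedGraph.bd1, h1, h2, finsum_mem_range (fun i j h => (Prod.mk.inj h).2),
    finsum_mem_range (fun i j h => (Prod.mk.inj h).2), finsum_eq_sum_of_fintype,
    finsum_eq_sum_of_fintype]

theorem continuous_apply (X : Type*) (x : X) : Continuous fun f : L2 X => f x := by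
  have : (fun f : L2 X => f x) = fun f => inner ℝ (L2.delta x) f := by
    funext f; rw [L2.inner_delta_left]
  rw [this]
  fun_prop

theorem bd1_eq_zero_of_mem_l2c {f : L2 (Γ × ι)} (hf : f ∈ (cayley s).l2c) (v : Γ) :
    (cayley s).bd1 f v = 0 := by
  have hc : IsClosed {f : L2 (Γ × ι) | (cayley s).bd1 f v = 0} := by
    simp only [bd1_cayley]
    have h1 : Continuous fun f : L2 (Γ × ι) => (∑ i, f (v * (s i)⁻¹, i) : ℝ) :=
      continuous_finsetSum _ fun i _ => continuous_apply _ _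
    have h2 : Continuous fun f : L2 (Γ × ι) => (∑ i, f (v, i) : ℝ) :=
      continuous_finsetSum _ fun i _ => continuous_apply _ _
    exact isClosed_eq (h1.sub h2) continuous_const
  exact closure_minimal (fun f hf => hf.2 v) hc hf

open Classical in
/-- The chain of a closed path is a finite cycle. -/
theorem mem_finiteCycles_of_walkChain {f : L2 (Γ × ι)} {l : List ((Γ × ι) × Bool)} {v : Γ}
    (hl : (cayley s).IsWalk v l v) (hf : ∀ e, f e = OrientedGraph.walkChain l e) :
    f ∈ (cayley s).finiteCycles := by
  refine ⟨(l.map Prod.fst).toFinset.finite_toSet.subset fun e he => ?_, fun x => ?_⟩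
  · rw [Function.mem_support, hf] at he
    by_contra h
    exact he (OrientedGraph.walkChain_eq_zero (by simpa using h))
  -- The value of `∂` at `x` is the integral of the differential of the indicator of `x`, which
  -- vanishes along a closed path.
  · have h1 := (cayley s).integral_d0 (fun y => if y = x then 1 else 0) hl
    rw [sub_self] at h1
    rw [bd1_cayley, ← h1]
    simp only [hf, OrientedGraph.walkChain_eq_integral]
    clear hf h1 hl
    induction l with
    | nil => simp
    | cons d l ih =>
      simp only [integral_cons]
      rw [← ih, Finset.sum_add_distrib, Finset.sum_add_distrib, add_sub_add_comm]
      congr 1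
      obtain ⟨⟨h, i⟩, b⟩ := d
      have e1 : ∀ (j : ι), (h = x * (s j)⁻¹ ∧ i = j) ↔ (i = j ∧ h * s i = x) := by
        intro j
        constructor
        · rintro ⟨rfl, rfl⟩; simp
        · rintro ⟨rfl, rfl⟩; simp
      have e2 : ∀ (j : ι), (h = x ∧ i = j) ↔ (i = j ∧ h = x) := fun j => and_comm
      cases b <;>
      simp [OrientedGraph.d0, cayley, e1, e2, ite_and] <;>
      by_cases h1 : h = x <;> by_cases h2 : h * s i = x <;> by_cases h3 : s i = 1 <;>
      simp [h1, h2, h3]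

end Cycles

/-! ### Kesten's inequality through the free group -/

section Nonamenability

/-- At most one of the four letters cancels against the first letter of `w`; for `w ≠ 1` the sum is
`3 (n + 1) + (n - 1)`, where `n` is the length. -/
theorem freeGroup_norm_letter_mul (w : FreeGroup Bool) :
    4 * w.norm + 2 ≤ ∑ b : Bool,
      ((FreeGroup.of b * w).norm + ((FreeGroup.of b)⁻¹ * w).norm) := by
  have h1 : ∀ x : Bool × Bool, (FreeGroup.mk [x] * w).norm =
      (FreeGroup.reduce (x :: w.toWord)).length := by
    intro x
    rw [FreeGroup.norm]
    conv_lhs => rw [← FreeGroup.mk_toWord (x := w), FreeGroup.mul_mk, FreeGroup.toWord_mk]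
    rfl
  have h2 : ∀ b : Bool, FreeGroup.of b = FreeGroup.mk [(b, true)] := fun b => rfl
  have h3 : ∀ b : Bool, (FreeGroup.of b)⁻¹ = FreeGroup.mk [(b, false)] := fun b => rfl
  have h4 : FreeGroup.reduce w.toWord = w.toWord := FreeGroup.reduce_toWord w
  rw [Fintype.sum_bool, h3, h3, h2, h2, h1, h1, h1, h1, FreeGroup.norm]
  simp only [FreeGroup.reduce.cons, h4]
  generalize w.toWord = L
  rcases L with _ | ⟨⟨b, s⟩, L⟩
  · simp
  · cases b <;> cases s <;> simp <;> omega

theorem freeGroup_norm_mul_letter (w : FreeGroup Bool) :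
    4 * w.norm + 2 ≤ ∑ b : Bool,
      ((w * FreeGroup.of b).norm + (w * (FreeGroup.of b)⁻¹).norm) := by
  have h := freeGroup_norm_letter_mul w⁻¹
  rw [FreeGroup.norm_inv_eq] at h
  refine h.trans (le_of_eq (Finset.sum_congr rfl fun b _ => ?_))
  rw [← FreeGroup.norm_inv_eq (x := FreeGroup.of b * w⁻¹),
    ← FreeGroup.norm_inv_eq (x := (FreeGroup.of b)⁻¹ * w⁻¹), mul_inv_rev, mul_inv_rev,
    inv_inv, inv_inv, add_comm]

variable {Γ : Type*} [Group Γ]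

set_option maxHeartbeats 1000000 in
/-- Kesten's inequality for a group that maps onto the free group of rank 2. -/
theorem sum_sq_le_of_hom_freeGroup (φ : Γ →* FreeGroup Bool) (s : Bool → Γ)
    (hs : ∀ b, φ (s b) = FreeGroup.of b) (α : L2 Γ) :
    ‖α‖ ^ 2 ≤ 2 * ∑ b, ∑' h, (α (h * s b) - α h) ^ 2 := by
  set N : Γ → ℝ := fun h => ((φ h).norm : ℝ)
  set F : Γ → ℝ := fun h => α h ^ 2
  have hF : Summable F := L2.summable_sq α
  have hF0 : ∀ h, 0 ≤ F h := fun h => sq_nonneg _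
  have hFs : ∀ b, Summable fun h => F (h * s b) := fun b =>
    (Equiv.mulRight (s b)).summable_iff.2 hF
  have hFt : ∀ b, ∑' h, F (h * s b) = ∑' h, F h := fun b =>
    (Equiv.mulRight (s b)).tsum_eq F
  -- The gradient of the word length, viewed as a flow: it is at most 1 on every edge while its
  -- divergence is at least 2 everywhere.
  set θ : Bool → Γ → ℝ := fun b h => N (h * s b) - N h
  have hθ : ∀ b h, |θ b h| ≤ 1 := by
    intro b h
    have h1 : (φ h * FreeGroup.of b).norm ≤ (φ h).norm + 1 := by
      refine (FreeGroup.norm_mul_le _ _).trans ?_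
      rw [FreeGroup.norm_of]
    have h2 : (φ h).norm ≤ (φ h * FreeGroup.of b).norm + 1 := by
      have := FreeGroup.norm_mul_le (φ h * FreeGroup.of b) (FreeGroup.of b)⁻¹
      rwa [mul_inv_cancel_right, FreeGroup.norm_inv_eq, FreeGroup.norm_of] at this
    simp only [θ, N, map_mul, hs]
    rw [abs_le]
    constructor
    · have : ((φ h).norm : ℝ) ≤ (φ h * FreeGroup.of b).norm + 1 := by exact_mod_cast h2
      linarith
    · have : ((φ h * FreeGroup.of b).norm : ℝ) ≤ (φ h).norm + 1 := by exact_mod_cast h1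
      linarith
  have hdiv : ∀ h, 2 ≤ ∑ b, (θ b h - θ b (h * (s b)⁻¹)) := by
    intro h
    have h1 := freeGroup_norm_mul_letter (φ h)
    have h2 : (4 * N h + 2 : ℝ) ≤ ∑ b : Bool, (N (h * s b) + N (h * (s b)⁻¹)) := by
      simp only [N, map_mul, map_inv, hs]
      exact_mod_cast h1
    simp only [θ, inv_mul_cancel_right, Fintype.sum_bool] at h2 ⊢
    linarith
  have hbd : ∀ (k : Γ → Γ) b (G : Γ → ℝ), Summable G → Summable fun h => θ b (k h) * G h := by
    intro k b G hG
    refine Summable.of_norm_bounded hG.norm fun h => ?_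
    rw [norm_mul]
    exact mul_le_of_le_one_left (norm_nonneg _) (hθ b _)
  have hb : ∀ b, ∑' h, (θ b h - θ b (h * (s b)⁻¹)) * F h ≤
      2 * ∑' h, (α (h * s b) - α h) ^ 2 + 1 / 2 * ∑' h, F h := by
    intro b
    -- Summation by parts moves the divergence of the flow onto differences of `α ^ 2`.
    have e1 : ∑' h, θ b (h * (s b)⁻¹) * F h = ∑' h, θ b h * F (h * s b) := by
      rw [← (Equiv.mulRight (s b)).tsum_eq]
      simp
    have hsum : Summable fun h => (α (h * s b) - α h) ^ 2 := by
      refine Summable.of_nonneg_of_le (fun h => sq_nonneg _) (fun h => ?_)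
        (((hFs b).add hF).mul_left 2)
      simp only [F]
      nlinarith [sq_nonneg (α (h * s b) + α h)]
    have e2 : ∑' h, (θ b h - θ b (h * (s b)⁻¹)) * F h =
        ∑' h, θ b h * (F h - F (h * s b)) := by
      simp only [sub_mul, mul_sub]
      have s1 : Summable fun h => θ b h * F h := hbd id b F hF
      have s2 : Summable fun h => θ b (h * (s b)⁻¹) * F h := hbd _ b F hF
      have s3 : Summable fun h => θ b h * F (h * s b) := hbd id b _ (hFs b)
      rw [s1.tsum_sub s2, e1, s1.tsum_sub s3]
    rw [e2]
    -- The constants come from `|x² - y²| ≤ 2 (x - y)² + (x² + y²) / 4`. Summed over both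
    -- generators, the last term costs `‖α‖²`, half of the `2 ‖α‖²` supplied by the divergence.
    have e3 : ∑' h, (2 * (α (h * s b) - α h) ^ 2 + 1 / 4 * (F (h * s b) + F h)) =
        2 * ∑' h, (α (h * s b) - α h) ^ 2 + 1 / 2 * ∑' h, F h := by
      rw [(hsum.mul_left 2).tsum_add (((hFs b).add hF).mul_left _), tsum_mul_left, tsum_mul_left,
        (hFs b).tsum_add hF, hFt]
      ring
    rw [← e3]
    refine (hbd id b _ (hF.sub (hFs b))).tsum_le_tsum (fun h => ?_)
      ((hsum.mul_left 2).add (((hFs b).add hF).mul_left _))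
    simp only [F]
    obtain ⟨h1, h2⟩ := abs_le.1 (hθ b h)
    set x := α h
    set y := α (h * s b)
    have h3 : θ b h * (x ^ 2 - y ^ 2) ≤ |x ^ 2 - y ^ 2| := by
      refine (le_abs_self _).trans ?_
      rw [abs_mul]
      exact mul_le_of_le_one_left (abs_nonneg _) (hθ b h)
    refine h3.trans (abs_le.2 ⟨?_, ?_⟩)
    · nlinarith [sq_nonneg (4 * (y - x) - (x + y)), sq_nonneg (x - y)]
    · nlinarith [sq_nonneg (4 * (y - x) + (x + y)), sq_nonneg (x - y)]
  have hmain : 2 * ∑' h, F h ≤ ∑ b, ∑' h, (θ b h - θ b (h * (s b)⁻¹)) * F h := by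
    have hsm : ∀ b, Summable fun h => (θ b h - θ b (h * (s b)⁻¹)) * F h := by
      intro b
      simp only [sub_mul]
      exact (hbd id b F hF).sub (hbd _ b F hF)
    rw [← Summable.tsum_finsetSum fun b _ => hsm b, ← tsum_mul_left]
    refine (hF.mul_left 2).tsum_le_tsum (fun h => ?_) (summable_sum fun b _ => hsm b)
    rw [← Finset.sum_mul]
    exact mul_le_mul_of_nonneg_right (hdiv h) (hF0 h)
  have h2 := hmain.trans (Finset.sum_le_sum fun b _ => hb b)
  rw [Finset.sum_add_distrib, ← Finset.mul_sum] at h2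
  simp only [Finset.sum_const, Finset.card_univ, Fintype.card_bool] at h2
  rw [L2.norm_sq]
  simp only [nsmul_eq_mul] at h2
  push_cast at h2
  change ∑' h, F h ≤ _
  linarith

end Nonamenability

/-! ### The relator, its partial products, and potentials -/

section SurfaceWords

variable {g : ℕ}

/-- The word `a_i b_i a_i⁻¹ b_i⁻¹`. -/
def handle (i : Fin g) : List (Gen g × Bool) :=
  [((i, false), true), ((i, true), true), ((i, false), false), ((i, true), false)]

/-- The relator of the surface group as a list of letters. -/
def relWord (g : ℕ) : List (Gen g × Bool) := (List.finRange g).flatMap handle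

/-- The product of the first `n` commutators. -/
def pre (n : ℕ) : SurfaceGroup g := wordVal gen (((List.finRange g).take n).flatMap handle)

theorem take_finRange_succ {n : ℕ} (hn : n < g) :
    (List.finRange g).take (n + 1) = (List.finRange g).take n ++ [⟨n, hn⟩] := by
  rw [← List.take_concat_get' _ _ (by simpa using hn)]
  simp

@[simp] theorem pre_zero : (pre 0 : SurfaceGroup g) = 1 := by simp [pre]

theorem wordVal_handle (i : Fin g) : wordVal gen (handle i) =
    (gen (i, false) * gen (i, true) * (gen (i, false))⁻¹ * (gen (i, true))⁻¹ :
      SurfaceGroup g) := by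
  simp [handle, letterVal, mul_assoc]

theorem pre_succ (i : Fin g) : (pre (i + 1) : SurfaceGroup g) =
    pre i * gen (i, false) * gen (i, true) * (gen (i, false))⁻¹ * (gen (i, true))⁻¹ := by
  rw [pre, take_finRange_succ i.2, List.flatMap_append, wordVal_append, ← pre]
  simp [wordVal_handle, mul_assoc]

theorem surfaceRelator_eq_mk : surfaceRelator g = FreeGroup.mk (relWord g) := by
  rw [surfaceRelator, relWord]
  induction List.finRange g with
  | nil => rfl
  | cons i l ih =>
    rw [List.map_cons, List.prod_cons, ih, List.flatMap_cons, ← FreeGroup.mul_mk]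
    rfl

theorem lift_gen_eq_mk (r : FreeGroup (Gen g)) :
    FreeGroup.lift (gen (g := g)) r = PresentedGroup.mk {surfaceRelator g} r := by
  have : FreeGroup.lift (gen (g := g)) = PresentedGroup.mk {surfaceRelator g} := by
    ext x
    rw [FreeGroup.lift_apply_of]
    rfl
  rw [this]

theorem wordVal_relWord : wordVal gen (relWord g) = (1 : SurfaceGroup g) := by
  rw [wordVal_eq_lift, ← surfaceRelator_eq_mk, lift_gen_eq_mk]
  exact PresentedGroup.one_of_mem rfl

@[simp] theorem pre_last : (pre g : SurfaceGroup g) = 1 := by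
  rw [pre, List.take_of_length_le (by simp)]
  exact wordVal_relWord

/-- The partial products of the relator: `cornerElt i r` is the value of the initial segment of
length `4 i + r`. -/
def cornerElt (i : Fin g) : ℕ → SurfaceGroup g
  | 0 => pre i
  | 1 => pre i * gen (i, false)
  | 2 => pre i * gen (i, false) * gen (i, true)
  | 3 => pre i * gen (i, false) * gen (i, true) * (gen (i, false))⁻¹
  | _ => pre (i + 1)

/-- An inverse letter passes an edge backwards, so that edge is based at the partial product after
the letter: hence the indices 3 and 4. -/
theorem path_relWord (m : SurfaceGroup g) : path gen m (relWord g) =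
    (List.finRange g).flatMap fun i =>
      [((m * cornerElt i 0, (i, false)), true), ((m * cornerElt i 1, (i, true)), true),
        ((m * cornerElt i 3, (i, false)), false), ((m * cornerElt i 4, (i, true)), false)] := by
  have key : ∀ n ≤ g, path gen m (((List.finRange g).take n).flatMap handle) =
      ((List.finRange g).take n).flatMap fun i =>
      [((m * cornerElt i 0, (i, false)), true), ((m * cornerElt i 1, (i, true)), true),
        ((m * cornerElt i 3, (i, false)), false), ((m * cornerElt i 4, (i, true)), false)] := by
    intro n
    induction n with
    | zero => intro _; rfl
    | succ n ih =>
      intro hn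
      rw [take_finRange_succ hn, List.flatMap_append, path_append, ih (by omega),
        List.flatMap_append, ← pre]
      congr 1
      have h1 := pre_succ (⟨n, hn⟩ : Fin g)
      simp only at h1
      simp [handle, path_cons, dart, letterVal, cornerElt, h1, mul_assoc]
  have := key g le_rfl
  rwa [List.take_of_length_le (by simp)] at this

/-- The homomorphism from the surface group given by the images of the canonical generators. -/
def surfaceHom {G' : Type*} [Group G'] (A B : Fin g → G')
    (h : ((List.finRange g).map fun i => A i * B i * (A i)⁻¹ * (B i)⁻¹).prod = 1) :
    SurfaceGroup g →* G' :=
  PresentedGroup.toGroup (f := fun x : Gen g => if x.2 then B x.1 else A x.1) (by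
    rintro r rfl
    rw [surfaceRelator, map_list_prod, List.map_map, ← h]
    congr 2
    funext i
    simp)

section SurfaceHom

variable {G' : Type*} [Group G'] (A B : Fin g → G')
    (h : ((List.finRange g).map fun i => A i * B i * (A i)⁻¹ * (B i)⁻¹).prod = 1)

@[simp] theorem surfaceHom_fst (i : Fin g) : surfaceHom A B h (gen (i, false)) = A i := by
  rw [surfaceHom, gen, PresentedGroup.toGroup.of]
  simp

@[simp] theorem surfaceHom_snd (i : Fin g) : surfaceHom A B h (gen (i, true)) = B i := by
  rw [surfaceHom, gen, PresentedGroup.toGroup.of]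
  simp

theorem surfaceHom_pre (n : ℕ) : surfaceHom A B h (pre n) =
    (((List.finRange g).take n).map fun i => A i * B i * (A i)⁻¹ * (B i)⁻¹).prod := by
  rw [pre]
  induction (List.finRange g).take n with
  | nil => simp
  | cons i l ih => simp [wordVal_handle, ih]

end SurfaceHom

/-- The exponent sum of a generator. -/
def exponentSum (x : Gen g) : SurfaceGroup g →* Multiplicative ℤ :=
  surfaceHom (fun i => Multiplicative.ofAdd (if x = (i, false) then 1 else 0))
    (fun i => Multiplicative.ofAdd (if x = (i, true) then 1 else 0)) (by
      simp)

theorem exponentSum_pre (x : Gen g) (n : ℕ) : exponentSum x (pre n) = 1 := by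
  rw [exponentSum, surfaceHom_pre]
  simp

theorem exponentSum_gen (x y : Gen g) :
    exponentSum x (gen y) = Multiplicative.ofAdd (if x = y then 1 else 0) := by
  obtain ⟨i, b⟩ := y
  cases b <;> simp [exponentSum]

theorem exponentSum_fst_cornerElt (i j : Fin g) {r : ℕ} (hr : r < 4) :
    exponentSum (i, false) (cornerElt j r) =
      Multiplicative.ofAdd (if i = j ∧ (r = 1 ∨ r = 2) then 1 else 0) := by
  interval_cases r <;> simp [cornerElt, exponentSum_pre, exponentSum_gen]

theorem exponentSum_snd_cornerElt (i j : Fin g) {r : ℕ} (hr : r < 4) :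
    exponentSum (i, true) (cornerElt j r) =
      Multiplicative.ofAdd (if i = j ∧ (r = 2 ∨ r = 3) then 1 else 0) := by
  interval_cases r <;> simp [cornerElt, exponentSum_pre, exponentSum_gen]

/-- Exponent sums cannot separate products of commutators, so a map to the symmetric group on three
letters is used: handle `i` goes to the pair `x, y` and handle `j` to `y, x`. The commutators are
mutually inverse, so the relator is respected, and strictly between the two handles the product is
`[x, y] ≠ 1`. -/
theorem pre_ne_pre {i j : Fin g} (hij : i < j) : (pre i : SurfaceGroup g) ≠ pre j := by
  let x : Equiv.Perm (Fin 3) := Equiv.swap 0 1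
  let y : Equiv.Perm (Fin 3) := Equiv.swap 1 2
  let A : Fin g → Equiv.Perm (Fin 3) := fun k => if k = i then x else if k = j then y else 1
  let B : Fin g → Equiv.Perm (Fin 3) := fun k => if k = i then y else if k = j then x else 1
  have key : ∀ n ≤ g, (((List.finRange g).take n).map
      fun i => A i * B i * (A i)⁻¹ * (B i)⁻¹).prod =
        if n ≤ i then 1 else if n ≤ j then x * y * x⁻¹ * y⁻¹ else 1 := by
    intro n
    induction n with
    | zero => intro _; simp
    | succ n ih =>
      intro hn
      rw [take_finRange_succ hn, List.map_append, List.prod_append, ih (by omega)]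
      rw [Fin.lt_def] at hij
      simp only [List.map_cons, List.map_nil, List.prod_cons, List.prod_nil, mul_one, A, B,
        Fin.ext_iff]
      by_cases h1 : n = i
      · have h2 : n ≤ j := by omega
        rw [if_pos (by omega), if_pos h1, if_pos h1, if_neg (by omega), if_pos (by omega), one_mul]
      · by_cases h2 : n = j
        · rw [if_neg (by omega), if_pos (by omega), if_neg h1, if_pos h2, if_neg h1, if_pos h2,
            if_neg (by omega), if_neg (by omega)]
          group
        · rw [if_neg h1, if_neg h2, if_neg h1, if_neg h2]
          have e1 : n ≤ i ↔ n + 1 ≤ i := by omega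
          have e2 : n ≤ j ↔ n + 1 ≤ j := by omega
          simp only [e1, e2]
          simp
  have hfull := key g le_rfl
  rw [List.take_of_length_le (by simp), if_neg (by omega), if_neg (by omega)] at hfull
  intro h
  have h1 := congrArg (surfaceHom A B hfull) h
  rw [surfaceHom_pre, surfaceHom_pre, key _ i.2.le, key _ j.2.le, if_pos le_rfl,
    if_neg (by rw [Fin.lt_def] at hij; omega), if_pos le_rfl] at h1
  revert h1
  decide

/-- Inside handle `i` the exponent sums of `a_i` and `b_i` run through (0,0), (1,0), (1,1), (0,1),
and all others vanish. This determines the position except for starting points of handles, which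
`pre_ne_pre` separates. -/
theorem cornerElt_injective {i j : Fin g} {r r' : ℕ} (hr : r < 4) (hr' : r' < 4)
    (h : cornerElt i r = cornerElt j r') : i = j ∧ r = r' := by
  have h1 := fun k => congrArg (exponentSum (k, false)) h
  have h2 := fun k => congrArg (exponentSum (k, true)) h
  simp only [exponentSum_fst_cornerElt _ _ hr, exponentSum_fst_cornerElt _ _ hr',
    exponentSum_snd_cornerElt _ _ hr, exponentSum_snd_cornerElt _ _ hr',
    EmbeddingLike.apply_eq_iff_eq] at h1 h2
  by_cases hij : i = j
  · subst hij
    refine ⟨rfl, ?_⟩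
    have h1 := h1 i
    have h2 := h2 i
    interval_cases r <;> interval_cases r' <;> simp at h1 h2 ⊢
  · exfalso
    have e1 := h1 i
    have e2 := h2 i
    have e3 := h1 j
    have e4 := h2 j
    simp only [hij, Ne.symm hij, true_and, false_and, if_false] at e1 e2 e3 e4
    have hr0 : r = 0 := by
      interval_cases r <;> simp at e1 e2 ⊢
    have hr0' : r' = 0 := by
      interval_cases r' <;> simp at e3 e4 ⊢
    subst hr0 hr0'
    rcases lt_or_gt_of_ne hij with hlt | hlt
    · exact pre_ne_pre hlt h
    · exact pre_ne_pre hlt h.symm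

/-- Handles follow each other cyclically: after the last one the relator has returned to 1. -/
theorem cornerElt_four_eq (hg : 0 < g) (i : Fin g) : ∃ j : Fin g, cornerElt i 4 = cornerElt j 0 := by
  by_cases h : (i : ℕ) + 1 < g
  · exact ⟨⟨i + 1, h⟩, rfl⟩
  · refine ⟨⟨0, hg⟩, ?_⟩
    have : (i : ℕ) + 1 = g := by omega
    simp [cornerElt, this]

theorem src_path_relWord (m : SurfaceGroup g) : (path gen m (relWord g)).map (cayley gen).src =
    (List.finRange g).flatMap fun i =>
      [m * cornerElt i 0, m * cornerElt i 1, m * cornerElt i 2, m * cornerElt i 3] := by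
  rw [path_relWord, List.map_flatMap]
  congr 1
  funext i
  simp [OrientedGraph.src, cayley, cornerElt, pre_succ, mul_assoc]

theorem mem_src_path_relWord (m h : SurfaceGroup g) :
    h ∈ (path gen m (relWord g)).map (cayley gen).src ↔ ∃ i, ∃ r < 4, h = m * cornerElt i r := by
  rw [src_path_relWord, List.mem_flatMap]
  constructor
  · rintro ⟨i, -, hi⟩
    simp only [List.mem_cons, List.not_mem_nil, or_false] at hi
    rcases hi with h | h | h | h
    exacts [⟨i, 0, by norm_num, h⟩, ⟨i, 1, by norm_num, h⟩, ⟨i, 2, by norm_num, h⟩,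
      ⟨i, 3, by norm_num, h⟩]
  · rintro ⟨i, r, hr, rfl⟩
    refine ⟨i, List.mem_finRange i, ?_⟩
    interval_cases r <;> simp

/-- The relator loops are simple. -/
theorem isCycle_path_relWord (hg : 0 < g) (m : SurfaceGroup g) :
    (cayley gen).IsCycle (path gen m (relWord g)) := by
  have hne : ∀ {i j : Fin g} {r r' : ℕ}, r < 4 → r' < 4 → (i ≠ j ∨ r ≠ r') →
      m * cornerElt i r ≠ m * cornerElt j r' := by
    intro i j r r' hr hr' h h1
    have := cornerElt_injective hr hr' (mul_left_cancel h1)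
    tauto
  refine ⟨?_, ⟨m, ?_⟩, ?_, ?_⟩
  · intro h
    have h1 := (mem_src_path_relWord m (m * cornerElt ⟨0, hg⟩ 0)).2 ⟨_, 0, by norm_num, rfl⟩
    rw [h] at h1
    simp at h1
  · have := isWalk_path gen m (relWord g)
    rwa [wordVal_relWord, mul_one] at this
  · rw [src_path_relWord, List.nodup_flatMap]
    refine ⟨fun i _ => ?_, (List.nodup_finRange g).imp fun {i j} hij => ?_⟩
    · simp only [List.nodup_cons, List.mem_cons, List.not_mem_nil, or_false, not_or, List.nodup_nil,
        and_true, not_false_eq_true]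
      refine ⟨⟨?_, ?_, ?_⟩, ⟨?_, ?_⟩, ?_⟩ <;>
      exact hne (by norm_num) (by norm_num) (Or.inr (by norm_num))
    · intro x hx hy
      simp only [List.mem_cons, List.not_mem_nil, or_false] at hx hy
      rcases hx with rfl | rfl | rfl | rfl <;> rcases hy with h | h | h | h <;>
      exact hne (by norm_num) (by norm_num) (Or.inl hij) h
  · rw [path_relWord, List.map_flatMap, List.nodup_flatMap]
    refine ⟨fun i _ => ?_, (List.nodup_finRange g).imp fun {i j} hij => ?_⟩
    · have h1 : m * cornerElt i 0 ≠ m * cornerElt i 3 :=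
        hne (by norm_num) (by norm_num) (Or.inr (by norm_num))
      have h2 : m * cornerElt i 1 ≠ m * cornerElt i 4 := by
        obtain ⟨j, hj⟩ := cornerElt_four_eq hg i
        rw [hj]
        exact hne (by norm_num) (by norm_num) (Or.inr (by norm_num))
      simp [h1, h2]
    · intro x hx hy
      simp only [List.map_cons, List.map_nil, List.mem_cons, List.not_mem_nil, or_false] at hx hy
      rcases hx with rfl | rfl | rfl | rfl <;> rcases hy with h | h | h | h <;>
      simp_all

/-- A 1-cochain whose integrals along the relator loops vanish is a coboundary. -/
theorem exists_potential (u : SurfaceGroup g × Gen g → ℝ)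
    (hu : ∀ m, integral u (path gen m (relWord g)) = 0) :
    ∃ φ : SurfaceGroup g → ℝ, ∀ e, u e = (cayley gen).d0 φ e := by
  -- Let the generators act on `Γ × ℝ` so that the inverse of `x` goes along the edge `x` and adds
  -- the value of `u` there. Inverses appear because extending a path multiplies on the right.
  let σ : Gen g → Equiv.Perm (SurfaceGroup g × ℝ) := fun x =>
    { toFun := fun p => (p.1 * (gen x)⁻¹, p.2 - u (p.1 * (gen x)⁻¹, x))
      invFun := fun p => (p.1 * gen x, p.2 + u (p.1, x))
      left_inv := fun p => by simp
      right_inv := fun p => by simp }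
  have hinv : ∀ (w : List (Gen g × Bool)) (p : SurfaceGroup g × ℝ),
      (FreeGroup.lift σ (FreeGroup.mk w))⁻¹ p =
        (p.1 * wordVal gen w, p.2 + integral u (path gen p.1 w)) := by
    intro w
    induction w with
    | nil => intro p; simp [← FreeGroup.one_eq_mk]
    | cons x w ih =>
      intro p
      have h1 : FreeGroup.mk (x :: w) = FreeGroup.mk [x] * FreeGroup.mk w := by
        rw [FreeGroup.mul_mk]; rfl
      rw [h1, map_mul, mul_inv_rev, Equiv.Perm.mul_apply, path_cons, integral_cons, wordVal_cons]
      obtain ⟨x, b⟩ := x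
      have h2 : (FreeGroup.lift σ (FreeGroup.mk [(x, b)]))⁻¹ p =
          (p.1 * letterVal gen (x, b), p.2 + if (dart gen p.1 (x, b)).2 then
            u (dart gen p.1 (x, b)).1 else -u (dart gen p.1 (x, b)).1) := by
        cases b
        · simp [FreeGroup.lift_mk, letterVal, dart, σ, sub_eq_add_neg]
        · simp only [FreeGroup.lift_mk, List.map_cons, List.map_nil, List.prod_cons,
            List.prod_nil, mul_one, cond_true, letterVal, dart, if_true]
          rfl
      rw [h2, ih]
      simp [mul_assoc, add_assoc]
  -- The inverse relator leads back to the same group element and adds the loop integral, which is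
  -- zero; so the action factors through `Γ`.
  have hrel : ∀ r ∈ ({surfaceRelator g} : Set (FreeGroup (Gen g))), FreeGroup.lift σ r = 1 := by
    rintro r rfl
    rw [← inv_eq_one]
    ext1 p
    rw [surfaceRelator_eq_mk, hinv, wordVal_relWord, hu]
    simp
  let Ψ : SurfaceGroup g →* Equiv.Perm (SurfaceGroup g × ℝ) := PresentedGroup.toGroup hrel
  -- Acting on `(1, 0)` follows a path from 1 to `h`, so the second coordinate is a well-defined
  -- potential at `h`.
  have hΨ : ∀ h, ((Ψ h)⁻¹ (1, 0)).1 = h := by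
    intro h
    obtain ⟨r, rfl⟩ := PresentedGroup.mk_surjective _ h
    induction r using Quot.inductionOn with
    | _ w =>
      have h1 : Ψ (PresentedGroup.mk _ (FreeGroup.mk w)) = FreeGroup.lift σ (FreeGroup.mk w) := rfl
      have h2 := hinv w (1, 0)
      change ((Ψ (PresentedGroup.mk _ (FreeGroup.mk w)))⁻¹ (1, 0)).1 = _
      rw [h1, h2, wordVal_eq_lift, lift_gen_eq_mk, one_mul]
      rfl
  refine ⟨fun h => ((Ψ h)⁻¹ (1, 0)).2, ?_⟩
  rintro ⟨h, x⟩
  have h1 : Ψ (gen x) = σ x := PresentedGroup.toGroup.of hrel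
  have h2 : (Ψ (h * gen x))⁻¹ (1, 0) = (σ x)⁻¹ ((Ψ h)⁻¹ (1, 0)) := by
    rw [map_mul, mul_inv_rev, h1, Equiv.Perm.mul_apply]
  have h3 : ∀ p, (σ x)⁻¹ p = (p.1 * gen x, p.2 + u (p.1, x)) := fun p => rfl
  simp only [OrientedGraph.d0, cayley]
  rw [h2, h3, hΨ]
  simp

end SurfaceWords

theorem L2.norm_sq_prod {X J : Type*} [Fintype J] (u : L2 (X × J)) :
    ‖u‖ ^ 2 = ∑ j, ∑' x, u (x, j) ^ 2 := by
  have h := (L2.hasSum_stack fun j =>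
    L2.comp (fun x : X => (x, j)) (fun _ _ h => (Prod.mk.inj h).1) u).tsum_eq
  simp only [L2.norm_sq] at h ⊢
  exact h

theorem L2.orthonormal_delta {X Y : Type*} {m : Y → X} (hm : Function.Injective m) :
    Orthonormal ℝ fun y => (L2.delta (m y) : L2 X) := by
  classical
  rw [orthonormal_iff_ite]
  intro i j
  rw [L2.inner_delta_left, L2.delta_apply]
  simp [hm.eq_iff]

theorem integral_flatMap {E A : Type*} (f : E → ℝ) (l : List A) (F : A → List (E × Bool)) :
    integral f (l.flatMap F) = (l.map fun a => integral f (F a)).sum := by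
  induction l with
  | nil => rfl
  | cons a l ih => simp [integral_append, ih]

/-! ### The operator spanned by the relator loops: lower bound and range -/

section BoundaryOp

variable {g : ℕ}

/-- The operator `α ↦ ∑ α_m γ_m`, where `γ_m` is the chain of the relator loop at `m`. -/
def boundaryOp (g : ℕ) : L2 (SurfaceGroup g) →L[ℝ] L2 (SurfaceGroup g × Gen g) :=
  ContinuousLinearMap.adjoint (pathOp gen (relWord g))

theorem integral_path_relWord (u : SurfaceGroup g × Gen g → ℝ) (m : SurfaceGroup g) :
    integral u (path gen m (relWord g)) =
      ∑ i, (u (m * cornerElt i 0, (i, false)) + u (m * cornerElt i 1, (i, true)) -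
        u (m * cornerElt i 3, (i, false)) - u (m * cornerElt i 4, (i, true))) := by
  rw [path_relWord, integral_flatMap, Fin.sum_univ_def]
  congr 2
  funext i
  simp [integral]
  ring

theorem boundaryOp_apply_eq (α : L2 (SurfaceGroup g)) (e : SurfaceGroup g × Gen g)
    (x y : SurfaceGroup g)
    (h : ∀ m, integral (L2.delta e) (path gen m (relWord g)) = L2.delta x m - L2.delta y m) :
    boundaryOp g α e = α x - α y := by
  rw [← L2.inner_delta_right, boundaryOp, ContinuousLinearMap.adjoint_inner_left]
  have : pathOp gen (relWord g) (L2.delta e) = L2.delta x - L2.delta y := by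
    ext m
    rw [pathOp_apply, h]
    rfl
  rw [this, inner_sub_right, L2.inner_delta_right, L2.inner_delta_right]

/-- A `b_i`-edge occurs in relator loops once forwards, starting at partial product 1 of handle `i`,
and once backwards, based at partial product 4. The edges of type `b_i` already suffice for the
lower bound. -/
theorem boundaryOp_snd (α : L2 (SurfaceGroup g)) (h : SurfaceGroup g) (i : Fin g) :
    boundaryOp g α (h, (i, true)) =
      α (h * (cornerElt i 1)⁻¹) - α (h * (cornerElt i 4)⁻¹) := by
  classical
  refine boundaryOp_apply_eq _ _ _ _ fun m => ?_
  rw [integral_path_relWord]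
  simp only [L2.delta_apply, eq_mul_inv_iff_mul_eq, Prod.mk.injEq, Bool.false_eq_true, and_false,
    if_false, zero_add, sub_zero, and_true, Finset.sum_sub_distrib]
  simp [and_comm, ite_and]

/-- The map of the surface group onto the free group of rank 2. -/
def toFreeGroup (i₀ i₁ : Fin g) : SurfaceGroup g →* FreeGroup Bool :=
  surfaceHom (fun i => if i = i₀ then FreeGroup.of false else if i = i₁ then FreeGroup.of true
    else 1) (fun _ => 1) (by simp)

/-- The `b`-edges of two handles provide the differences of `α` along two elements that map to free
generators, so Kesten's inequality applies. -/
theorem norm_sq_le_boundaryOp (hg : 2 ≤ g) (α : L2 (SurfaceGroup g)) :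
    ‖α‖ ^ 2 ≤ 2 * ‖boundaryOp g α‖ ^ 2 := by
  let i : Bool → Fin g := fun b => if b then ⟨1, by omega⟩ else ⟨0, by omega⟩
  have hi : Function.Injective i := by
    intro a b hab
    cases a <;> cases b <;> simp [i] at hab ⊢
  -- The step between the two relator loops through a `b`-edge. When all `b_i` are killed,
  -- commutators die and this element goes to the image of `a_i`.
  let s : Bool → SurfaceGroup g := fun b => cornerElt (i b) 1 * (cornerElt (i b) 4)⁻¹
  have h10 : i true ≠ i false := hi.ne (by simp)
  have hs : ∀ b, toFreeGroup (i false) (i true) (s b) = FreeGroup.of b := by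
    intro b
    cases b <;>
    simp [s, cornerElt, pre_succ, toFreeGroup, surfaceHom_pre, h10]
  refine (sum_sq_le_of_hom_freeGroup (toFreeGroup (i false) (i true)) s hs α).trans ?_
  refine mul_le_mul_of_nonneg_left ?_ (by norm_num)
  rw [L2.norm_sq_prod]
  have h1 : ∀ b, ∑' h, (α (h * s b) - α h) ^ 2 =
      ∑' h, boundaryOp g α (h, (i b, true)) ^ 2 := by
    intro b
    rw [← (Equiv.mulRight (cornerElt (i b) 1)⁻¹).tsum_eq]
    refine tsum_congr fun h => ?_
    rw [boundaryOp_snd]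
    simp only [Equiv.coe_mulRight, s, mul_assoc, inv_mul_cancel_left]
    ring
  simp only [h1]
  have hinj : Function.Injective fun b => ((i b, true) : Gen g) := fun a b h =>
    hi (Prod.mk.inj h).1
  rw [← Finset.sum_image (s := Finset.univ) (g := fun b => ((i b, true) : Gen g))
    (f := fun x => ∑' h, boundaryOp g α (h, x) ^ 2) (fun a _ b _ h => hinj h)]
  exact Finset.sum_le_sum_of_subset_of_nonneg (Finset.subset_univ _) fun x _ _ =>
    tsum_nonneg fun h => sq_nonneg _

theorem boundaryOp_delta_mem_l2c (m : SurfaceGroup g) :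
    boundaryOp g (L2.delta m) ∈ (cayley (gen (g := g))).l2c := by
  refine Submodule.le_topologicalClosure _ ?_
  refine mem_finiteCycles_of_walkChain gen (l := path gen m (relWord g)) (v := m) ?_ fun e => ?_
  · have := isWalk_path gen m (relWord g)
    rwa [wordVal_relWord, mul_one] at this
  · exact adjoint_pathOp_delta _ _ _ _

/-- The image of `boundaryOp` contains everything that is orthogonal to coboundaries. -/
theorem exists_boundaryOp_eq (hg : 2 ≤ g) (f : L2 (SurfaceGroup g × Gen g))
    (hf : ∀ (u : L2 (SurfaceGroup g × Gen g)) (φ : SurfaceGroup g → ℝ),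
      (∀ e, u e = (cayley gen).d0 φ e) → inner ℝ f u = 0) :
    ∃ α, boundaryOp g α = f := by
  -- The lower bound makes the range closed, so it equals the orthogonal complement of the kernel of
  -- the adjoint, that is, of the square-summable coboundaries.
  have hclosed : IsClosed (Set.range (boundaryOp g)) := by
    have hanti : AntilipschitzWith 2 (boundaryOp g) := by
      refine AddMonoidHomClass.antilipschitz_of_bound _ fun α => ?_
      have h1 := norm_sq_le_boundaryOp hg α
      refine (sq_le_sq₀ (norm_nonneg _) (by positivity)).1 ?_
      rw [mul_pow]
      refine h1.trans ?_
      push_cast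
      nlinarith [sq_nonneg ‖boundaryOp g α‖]
    exact hanti.isClosed_range (boundaryOp g).uniformContinuous
  have h1 : f ∈ (boundaryOp g).range.topologicalClosure := by
    rw [← Submodule.orthogonal_orthogonal_eq_closure, ContinuousLinearMap.orthogonal_range,
      Submodule.mem_orthogonal']
    intro u hu
    have hu' : ∀ m, integral u (path gen m (relWord g)) = 0 := by
      intro m
      rw [boundaryOp, ContinuousLinearMap.adjoint_adjoint] at hu
      rw [← pathOp_apply]
      have : pathOp gen (relWord g) u = 0 := hu
      rw [this]
      rfl
    obtain ⟨φ, hφ⟩ := exists_potential u hu'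
    exact hf u φ hφ
  have h2 : f ∈ Set.range (boundaryOp g) := by
    rw [← hclosed.closure_eq]
    exact h1
  exact h2

/-- A cycle orthogonal to all relator loops vanishes. -/
theorem eq_zero_of_mem_l2c {u : L2 (SurfaceGroup g × Gen g)}
    (hu : u ∈ (cayley (gen (g := g))).l2c)
    (h : ∀ m, inner ℝ (boundaryOp g (L2.delta m)) u = 0) : u = 0 := by
  have hu' : ∀ m, integral u (path gen m (relWord g)) = 0 := by
    intro m
    have := h m
    rwa [boundaryOp, ContinuousLinearMap.adjoint_inner_left, L2.inner_delta_left,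
      pathOp_apply] at this
  obtain ⟨φ, hφ⟩ := exists_potential u hu'
  have := inner_coboundary_of_mem_l2c _ hu φ u hφ
  simpa using this

/-- Chains equal up to signs to those of the relator loops form a Riesz basis. -/
theorem isRieszBasis_of_signs (hg : 2 ≤ g) {I : Type*} (m : I ≃ SurfaceGroup g) (κ : I → ℝ)
    (hκ : ∀ v, κ v = 1 ∨ κ v = -1) (γ : I → (cayley (gen (g := g))).l2c)
    (hγ : ∀ v, (γ v : L2 (SurfaceGroup g × Gen g)) = κ v • boundaryOp g (L2.delta (m v))) :
    IsRieszBasis γ := by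
  have hκ2 : ∀ v, κ v * κ v = 1 := fun v => by rcases hκ v with h | h <;> rw [h] <;> norm_num
  constructor
  -- One constant for both sides: the operator norm serves the upper bound and 2 the lower one. The
  -- signs `κ` are absorbed into the coefficients.
  · refine ⟨‖boundaryOp g‖ ^ 2 + 2, by positivity, fun a => ?_⟩
    set α : L2 (SurfaceGroup g) := ∑ v ∈ a.support, (a v * κ v) • L2.delta (m v) with hα
    have hsum : a.sum (fun _ x => x ^ 2) = ‖α‖ ^ 2 := by
      rw [← real_inner_self_eq_norm_sq, hα,
        (L2.orthonormal_delta m.injective).inner_sum, Finsupp.sum]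
      refine Finset.sum_congr rfl fun v _ => ?_
      have := hκ2 v
      simp only [conj_trivial]
      linear_combination (-(a v) ^ 2) * this
    have hB : ((a.sum fun i x => x • γ i : (cayley (gen (g := g))).l2c) :
        L2 (SurfaceGroup g × Gen g)) = boundaryOp g α := by
      rw [Finsupp.sum, hα, map_sum, Submodule.coe_sum]
      refine Finset.sum_congr rfl fun v _ => ?_
      rw [Submodule.coe_smul, hγ, map_smul, smul_smul]
    have hnorm : ‖a.sum fun i x => x • γ i‖ = ‖boundaryOp g α‖ := by
      rw [← hB]
      rfl
    rw [hnorm, hsum]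
    have h1 := norm_sq_le_boundaryOp hg α
    constructor
    · rw [inv_mul_le_iff₀ (by positivity)]
      nlinarith [sq_nonneg ‖boundaryOp g‖, sq_nonneg ‖boundaryOp g α‖,
        mul_nonneg (sq_nonneg ‖boundaryOp g‖) (sq_nonneg ‖boundaryOp g α‖)]
    · have h2 := pow_le_pow_left₀ (norm_nonneg _) ((boundaryOp g).le_opNorm α) 2
      rw [mul_pow] at h2
      nlinarith [sq_nonneg ‖α‖]
  · have : CompleteSpace (cayley (gen (g := g))).l2c :=
      Submodule.topologicalClosure.completeSpace _
    rw [Submodule.topologicalClosure_eq_top_iff, Submodule.eq_bot_iff]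
    intro u hu
    rw [Submodule.mem_orthogonal] at hu
    have h0 : (u : L2 (SurfaceGroup g × Gen g)) = 0 := by
      refine eq_zero_of_mem_l2c u.2 fun x => ?_
      have h1 := hu _ (Submodule.subset_span ⟨m.symm x, rfl⟩)
      rw [Submodule.coe_inner, hγ, m.apply_symm_apply, real_inner_smul_left] at h1
      have h2 := hκ2 (m.symm x)
      rcases mul_eq_zero.1 h1 with h3 | h3
      · rw [h3] at h2; norm_num at h2
      · exact h3
    exact Subtype.ext h0

end BoundaryOp

/-! ### Vertices of the tessellation as group elements -/

section Vertices

variable {g : ℕ} {X : Type} (pt : SurfaceGroup g → ZMod (4 * g) → X)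

/-- Going around a vertex with the gluings, the corners of a handle occur in the order 0, 3, 2, 1,
4, while the tile is multiplied by successive letters of the relator. Hence corners 1 and 3 are
paired with partial products 3 and 1. -/
theorem pt_idx (hglue : ∀ x y, CornerGlue g x y → pt x.1 x.2 = pt y.1 y.2)
    (h : SurfaceGroup g) (i : Fin g) :
    pt h (idx i 0) = pt (h * (cornerElt i 0)⁻¹) 0 ∧
    pt h (idx i 1) = pt (h * (cornerElt i 3)⁻¹) 0 ∧
    pt h (idx i 2) = pt (h * (cornerElt i 2)⁻¹) 0 ∧
    pt h (idx i 3) = pt (h * (cornerElt i 1)⁻¹) 0 ∧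
    pt h (idx i 4) = pt (h * (cornerElt i 4)⁻¹) 0 := by
  have step : ∀ i : Fin g, (∀ h, pt h (idx i 0) = pt (h * (cornerElt i 0)⁻¹) 0) → ∀ h,
      pt h (idx i 1) = pt (h * (cornerElt i 3)⁻¹) 0 ∧
      pt h (idx i 2) = pt (h * (cornerElt i 2)⁻¹) 0 ∧
      pt h (idx i 3) = pt (h * (cornerElt i 1)⁻¹) 0 ∧
      pt h (idx i 4) = pt (h * (cornerElt i 4)⁻¹) 0 := by
    intro i h0
    have h3 : ∀ h, pt h (idx i 3) = pt (h * (cornerElt i 1)⁻¹) 0 := by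
      intro h
      have e := hglue _ _ (CornerGlue.a_fst (h * (gen (i, false))⁻¹) i)
      simp only [inv_mul_cancel_right] at e
      rw [e, h0]
      simp [cornerElt, mul_assoc]
    have h2 : ∀ h, pt h (idx i 2) = pt (h * (cornerElt i 2)⁻¹) 0 := by
      intro h
      have e := hglue _ _ (CornerGlue.b_fst (h * (gen (i, true))⁻¹) i)
      simp only [inv_mul_cancel_right] at e
      rw [e, h3]
      simp [cornerElt, mul_assoc]
    have h1 : ∀ h, pt h (idx i 1) = pt (h * (cornerElt i 3)⁻¹) 0 := by
      intro h
      have e := hglue _ _ (CornerGlue.a_snd h i)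
      simp only at e
      rw [← e, h2]
      simp [cornerElt, mul_assoc]
    have h4 : ∀ h, pt h (idx i 4) = pt (h * (cornerElt i 4)⁻¹) 0 := by
      intro h
      have e := hglue _ _ (CornerGlue.b_snd h i)
      simp only at e
      rw [← e, h1]
      simp [cornerElt, pre_succ, mul_assoc]
    exact fun h => ⟨h1 h, h2 h, h3 h, h4 h⟩
  have hzero : ∀ n (hn : n < g) h,
      pt h (idx ⟨n, hn⟩ 0) = pt (h * (cornerElt ⟨n, hn⟩ 0)⁻¹) 0 := by
    intro n
    induction n with
    | zero => intro hn h; simp [cornerElt, idx]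
    | succ n ih =>
      intro hn h
      have e := (step ⟨n, by omega⟩ (ih (by omega)) h).2.2.2
      have e1 : (idx ⟨n, by omega⟩ 4 : ZMod (4 * g)) = idx ⟨n + 1, hn⟩ 0 := by
        simp only [idx]
        congr 1
      rw [e1] at e
      exact e
  exact ⟨hzero i i.2 h, step i (hzero i i.2) h⟩

theorem exists_idx (hg : 0 < g) (k : ZMod (4 * g)) : ∃ i : Fin g, ∃ r < 4, k = idx i r := by
  have : NeZero (4 * g) := ⟨by omega⟩
  have hk := ZMod.val_lt k
  refine ⟨⟨k.val / 4, by omega⟩, k.val % 4, by omega, ?_⟩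
  rw [idx]
  conv_lhs => rw [← ZMod.natCast_zmod_val k]
  congr 1
  simp only
  omega

theorem idx_succ (i : Fin g) (r : ℕ) : idx i r + 1 = idx i (r + 1) := by
  simp only [idx]
  push_cast
  ring

/-- The loops around the vertices form a Riesz basis whenever the corners are identified exactly as
the gluing prescribes. -/
theorem vertexCyclesFormRieszBasis_of_glue (hg : 2 ≤ g)
    (hglue : ∀ x y, CornerGlue g x y → pt x.1 x.2 = pt y.1 y.2)
    (hinj : ∀ m m', pt m 0 = pt m' 0 → m = m') : VertexCyclesFormRieszBasis pt := by
  have hg0 : 0 < g := by omega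
  have hpt := pt_idx pt hglue
  have hvert : ∀ v ∈ vertexSet pt, ∃ m, pt m 0 = v := by
    rintro v ⟨h, k, rfl⟩
    obtain ⟨i, r, hr, rfl⟩ := exists_idx hg0 k
    obtain ⟨h0, h1, h2, h3, -⟩ := hpt h i
    interval_cases r
    exacts [⟨_, h0.symm⟩, ⟨_, h1.symm⟩, ⟨_, h2.symm⟩, ⟨_, h3.symm⟩]
  -- Because corners 0 determine their tiles, incidence of a corner with a vertex becomes an
  -- equation in the group.
  have hiff : ∀ x m c : SurfaceGroup g, pt (x * c⁻¹) 0 = pt m 0 ↔ x = m * c := fun x m c =>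
    ⟨fun h => by rw [← hinj _ _ h, inv_mul_cancel_right], fun h => by
      rw [h, mul_inv_cancel_right]⟩
  have hloop : ∀ m, IsLoopAround pt (pt m 0) (path gen m (relWord g)) := by
    intro m
    refine ⟨isCycle_path_relWord hg0 m, fun h => ?_, fun p hp => ?_⟩
    · rw [mem_src_path_relWord]
      constructor
      · rintro ⟨i, r, hr, hh⟩
        obtain ⟨h0, h1, h2, h3, -⟩ := hpt h i
        interval_cases r
        exacts [⟨_, h0.trans ((hiff _ _ _).2 hh)⟩, ⟨_, h3.trans ((hiff _ _ _).2 hh)⟩,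
          ⟨_, h2.trans ((hiff _ _ _).2 hh)⟩, ⟨_, h1.trans ((hiff _ _ _).2 hh)⟩]
      · rintro ⟨k, hk⟩
        obtain ⟨i, r, hr, rfl⟩ := exists_idx hg0 k
        obtain ⟨h0, h1, h2, h3, -⟩ := hpt h i
        interval_cases r
        exacts [⟨i, 0, by norm_num, (hiff _ _ _).1 (h0.symm.trans hk)⟩,
          ⟨i, 3, by norm_num, (hiff _ _ _).1 (h1.symm.trans hk)⟩,
          ⟨i, 2, by norm_num, (hiff _ _ _).1 (h2.symm.trans hk)⟩,
          ⟨i, 1, by norm_num, (hiff _ _ _).1 (h3.symm.trans hk)⟩]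
    · rw [path_relWord, List.mem_flatMap] at hp
      obtain ⟨i, -, hp⟩ := hp
      simp only [List.mem_cons, List.not_mem_nil, or_false] at hp
      rcases hp with rfl | rfl | rfl | rfl
      · left
        simp only [sideOf, Bool.false_eq_true, if_false]
        rw [(hpt _ i).1, mul_inv_cancel_right]
      · left
        simp only [sideOf, if_true]
        rw [(hpt _ i).2.2.2.1, mul_inv_cancel_right]
      · right
        simp only [sideOf, Bool.false_eq_true, if_false, idx_succ]
        rw [(hpt _ i).2.1, mul_inv_cancel_right]
      · right
        simp only [sideOf, if_true, idx_succ]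
        rw [(hpt _ i).2.2.2.2, mul_inv_cancel_right]
  -- An edge crossing a side at the vertex belongs to the relator loop there. Thus any admissible
  -- loop lies in the relator loop, and its chain agrees up to sign by `walkChain_eq_or_neg`.
  have hedges : ∀ m w, IsLoopAround pt (pt m 0) w → ∀ e ∈ w.map Prod.fst,
      e ∈ (path gen m (relWord g)).map Prod.fst := by
    rintro m w ⟨-, -, hw⟩ e he
    obtain ⟨⟨⟨h, i, b⟩, s⟩, hp, rfl⟩ := List.mem_map.1 he
    have h1 := hw _ hp
    rw [path_relWord, List.map_flatMap, List.mem_flatMap]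
    refine ⟨i, List.mem_finRange i, ?_⟩
    obtain ⟨e0, e1, -, e3, e4⟩ := hpt h i
    cases b
    · simp only [sideOf, Bool.false_eq_true, if_false, idx_succ] at h1
      rcases h1 with h1 | h1
      · rw [e0] at h1
        simp [(hiff _ _ _).1 h1.symm]
      · rw [e1] at h1
        simp [(hiff _ _ _).1 h1.symm]
    · simp only [sideOf, if_true, idx_succ] at h1
      rcases h1 with h1 | h1
      · rw [e3] at h1
        simp [(hiff _ _ _).1 h1.symm]
      · rw [e4] at h1
        simp [(hiff _ _ _).1 h1.symm]
  refine ⟨fun v hv => ?_, fun w hw => ?_⟩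
  · obtain ⟨m, rfl⟩ := hvert v hv
    exact ⟨_, hloop m⟩
  · choose μ hμ using fun v : vertexSet pt => hvert v v.2
    let M : vertexSet pt ≃ SurfaceGroup g :=
      { toFun := μ
        invFun := fun m => ⟨pt m 0, m, 0, rfl⟩
        left_inv := fun v => Subtype.ext (hμ v)
        right_inv := fun m => hinj _ _ (hμ _) }
    have hchain : ∀ v, ∃ κ : ℝ, (κ = 1 ∨ κ = -1) ∧ ∀ e,
        OrientedGraph.walkChain (w v) e =
          κ * OrientedGraph.walkChain (path gen (μ v) (relWord g)) e := by
      intro v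
      refine OrientedGraph.walkChain_eq_or_neg _ (isCycle_path_relWord hg0 (μ v)) (hw v).1
        (hedges (μ v) _ ?_)
      rw [hμ]
      exact hw v
    choose κ hκ hκw using hchain
    refine ⟨fun v => ⟨κ v • boundaryOp g (L2.delta (μ v)),
      Submodule.smul_mem _ _ (boundaryOp_delta_mem_l2c _)⟩, fun v e => ?_, ?_⟩
    · rw [hκw]
      change κ v * boundaryOp g (L2.delta (μ v)) e = _
      rw [boundaryOp, adjoint_pathOp_delta]
    · exact isRieszBasis_of_signs hg M κ hκ _ fun v => rfl

/-- The translation that moves corner number `k` of the base tile to corner number `0`. -/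
def cornerShift (k : ZMod (4 * g)) : SurfaceGroup g :=
  -- Position `r` in a handle is matched with partial product `4 - r`, reduced modulo 4 so that 0
  -- stays 0. For `g > 0` the default value is never taken.
  if hk : k.val / 4 < g then (cornerElt ⟨k.val / 4, hk⟩ ((4 - k.val % 4) % 4))⁻¹ else 1

theorem cornerShift_idx (i : Fin g) {r : ℕ} (hr : r < 4) :
    cornerShift (idx i r) = (cornerElt i ((4 - r) % 4))⁻¹ := by
  have hi := i.2
  have h1 : (idx i r : ZMod (4 * g)).val = 4 * i + r := by
    rw [idx, ZMod.val_natCast, Nat.mod_eq_of_lt (by omega)]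
  have h2 : (4 * (i : ℕ) + r) / 4 = i := by omega
  have h3 : (4 * (i : ℕ) + r) % 4 = r := by omega
  rw [cornerShift, h1]
  simp only [h2, h3, hi, dif_pos]

theorem cornerShift_idx_four (i : Fin g) :
    cornerShift (idx i 4) = (cornerElt i 4)⁻¹ := by
  have hi := i.2
  by_cases h : (i : ℕ) + 1 < g
  · have e1 : (idx i 4 : ZMod (4 * g)) = idx ⟨i + 1, h⟩ 0 := rfl
    rw [e1, cornerShift_idx _ (by norm_num)]
    rfl
  · have e2 : (i : ℕ) + 1 = g := by omega
    have e1 : (idx i 4 : ZMod (4 * g)) = idx ⟨0, by omega⟩ 0 := by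
      have : (4 * (i : ℕ) + 4 : ℕ) = 4 * g := by omega
      simp only [idx, this]
      simp
    rw [e1, cornerShift_idx _ (by norm_num)]
    simp [cornerElt, e2]

/-- The element `h * cornerShift k` is unchanged by every gluing, so it descends to vertices and
separates corners 0 of different tiles. -/
theorem vertexCyclesFormRieszBasis_abstract (hg : 2 ≤ g) :
    VertexCyclesFormRieszBasis (abstractCorner g) := by
  refine vertexCyclesFormRieszBasis_of_glue _ hg (fun x y h => Quot.sound h) fun m m' h => ?_
  let F : AbstractVertex g → SurfaceGroup g :=
    Quot.lift (fun x => x.1 * cornerShift x.2) (by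
      intro x y hxy
      cases hxy with
      | a_fst h i =>
        rw [cornerShift_idx i (by norm_num), cornerShift_idx i (by norm_num)]
        simp [cornerElt, mul_assoc]
      | a_snd h i =>
        rw [cornerShift_idx i (by norm_num), cornerShift_idx i (by norm_num)]
        simp [cornerElt, mul_assoc]
      | b_fst h i =>
        rw [cornerShift_idx i (by norm_num), cornerShift_idx i (by norm_num)]
        simp [cornerElt, mul_assoc]
      | b_snd h i =>
        rw [cornerShift_idx i (by norm_num), cornerShift_idx_four i]
        simp [cornerElt, pre_succ, mul_assoc])
  have h1 : m * cornerShift 0 = m' * cornerShift 0 := congrArg F h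
  exact mul_right_cancel h1

/-- If `m` and `m'` send corner 0 to the same point, then `m'⁻¹ m` fixes corner 0 of `P`, and
freeness makes it trivial. Of the geometry, only this and the side pairing enter. -/
theorem vertexCyclesFormRieszBasis_tessellation (hg : 2 ≤ g) (T : CanonicalTessellation g) :
    VertexCyclesFormRieszBasis T.tileCorner := by
  refine vertexCyclesFormRieszBasis_of_glue _ hg (fun x y h => ?_) fun m m' h => ?_
  · cases h with
    | a_fst h i => simp [CanonicalTessellation.tileCorner, ← (T.pair_a i).1]
    | a_snd h i => simp [CanonicalTessellation.tileCorner, ← (T.pair_a i).2]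
    | b_fst h i => simp [CanonicalTessellation.tileCorner, ← (T.pair_b i).1]
    | b_snd h i => simp [CanonicalTessellation.tileCorner, ← (T.pair_b i).2]
  · have h1 : T.ρ (m'⁻¹ * m) (T.corner 0) = T.corner 0 := by
      have h2 : T.ρ m (T.corner 0) = T.ρ m' (T.corner 0) := h
      rw [map_mul, map_inv, IsometryEquiv.mul_apply, h2]
      exact (T.ρ m').symm_apply_apply _
    exact (inv_mul_eq_one.1 (T.free _ _ h1)).symm

end Vertices

/-! ### The differential on faces and closed words -/

section FaceOp

variable {Γ ι : Type*} [Group Γ] (s : ι → Γ) {D : ℕ}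

theorem boundaryWalk_spec (c : (cayley s).Face D) :
    (cayley s).IsCycle c.boundaryWalk ∧ c.boundaryWalk.length ≤ D ∧
      c.1 = {e | e ∈ c.boundaryWalk.map Prod.fst} :=
  Classical.choose_spec c.2

/-- The starting vertex of the boundary of a face. -/
def faceStart (c : (cayley s).Face D) : Γ := (boundaryWalk_spec s c).1.2.1.choose

theorem path_faceStart (c : (cayley s).Face D) :
    path s (faceStart s c) (spell c.boundaryWalk) = c.boundaryWalk :=
  (eq_path_of_isWalk s (boundaryWalk_spec s c).1.2.1.choose_spec).1.symm

/-- The words of length at most `D`. -/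
abbrev ShortWord (ι : Type*) (D : ℕ) : Type _ := {w : List (ι × Bool) // w.length ≤ D}

/-- Faces are determined by the starting points and the spellings of their boundaries. -/
def faceCode (c : (cayley s).Face D) : Γ × ShortWord ι D :=
  (faceStart s c, ⟨spell c.boundaryWalk, by
    rw [spell, List.length_map]; exact (boundaryWalk_spec s c).2.1⟩)

theorem faceCode_injective : Function.Injective (faceCode s (D := D)) := by
  intro c c' h
  have h1 : faceStart s c = faceStart s c' := congrArg Prod.fst h
  have h2 : spell c.boundaryWalk = spell c'.boundaryWalk :=
    congrArg (fun x : Γ × ShortWord ι D => x.2.1) h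
  have h3 : c.boundaryWalk = c'.boundaryWalk := by
    rw [← path_faceStart s c, ← path_faceStart s c', h1, h2]
  apply Subtype.ext
  rw [(boundaryWalk_spec s c).2.2, (boundaryWalk_spec s c').2.2, h3]

theorem finite_path_mem (e : Γ × ι) (w : List (ι × Bool)) :
    {h | e ∈ (path s h w).map Prod.fst}.Finite := by
  induction w with
  | nil => simp
  | cons x w ih =>
    have h1 : {h | e ∈ (path s h (x :: w)).map Prod.fst} ⊆
        {h | e = (dart s h x).1} ∪
          (fun h => h * letterVal s x) ⁻¹' {h | e ∈ (path s h w).map Prod.fst} := by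
      intro h hh
      have h2 : e ∈ (path s h (x :: w)).map Prod.fst := hh
      rw [path_cons, List.map_cons, List.mem_cons] at h2
      exact h2
    refine Set.Finite.subset (Set.Finite.union ?_ (ih.preimage
      (mul_left_injective _).injOn)) h1
    refine Set.Subsingleton.finite fun a ha b hb => ?_
    have h3 : (dart s a x).1 = (dart s b x).1 := (Eq.symm ha).trans hb
    obtain ⟨i, t⟩ := x
    cases t <;> simpa [dart] using h3

variable [Finite ι]

instance : Finite (ShortWord ι D) := List.finite_length_le (ι × Bool) D

noncomputable instance : Fintype (ShortWord ι D) := Fintype.ofFinite _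

/-- `d` on square-summable 1-cochains. -/
def faceOp (D : ℕ) : L2 (Γ × ι) →L[ℝ] L2 ((cayley s).Face D) :=
  L2.comp (faceCode s) (faceCode_injective s) ∘L
    L2.stack fun w : ShortWord ι D => pathOp s w.1

theorem faceOp_apply (f : L2 (Γ × ι)) (c : (cayley s).Face D) :
    faceOp s D f c = integral f c.boundaryWalk := by
  conv_rhs => rw [← path_faceStart s c, ← pathOp_apply]
  rfl

/-- Local finiteness: there are finitely many words of length at most `D`, and each meets a given
edge from finitely many starting points. Otherwise the `finsum` in `bd2` could take its default
value 0. -/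
theorem finite_faces_mem (e : Γ × ι) :
    {c : (cayley s).Face D | OrientedGraph.walkChain c.boundaryWalk e ≠ 0}.Finite := by
  have h1 : (⋃ w : ShortWord ι D,
      (fun h => (h, w)) '' {h | e ∈ (path s h w.1).map Prod.fst}).Finite :=
    Set.finite_iUnion fun w => (finite_path_mem s e w.1).image _
  refine (h1.preimage (faceCode_injective s).injOn).subset fun c hc => ?_
  refine Set.mem_iUnion.2 ⟨(faceCode s c).2, faceStart s c, ?_, rfl⟩
  have h2 : e ∈ c.boundaryWalk.map Prod.fst := by
    by_contra h
    exact hc (OrientedGraph.walkChain_eq_zero h)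
  have h3 := path_faceStart s c
  change e ∈ (path s (faceStart s c) (spell c.boundaryWalk)).map Prod.fst
  rwa [h3]

theorem faceOp_delta (e : Γ × ι) (c : (cayley s).Face D) :
    faceOp s D (L2.delta e) c = OrientedGraph.walkChain c.boundaryWalk e := by
  classical
  rw [faceOp_apply, OrientedGraph.walkChain_eq_integral]
  congr 1
  funext x
  rw [L2.delta_apply]

theorem adjoint_faceOp_apply (φ : L2 ((cayley s).Face D)) (e : Γ × ι) :
    ContinuousLinearMap.adjoint (faceOp s D) φ e = (cayley s).bd2 D φ e := by
  rw [← L2.inner_delta_right, ContinuousLinearMap.adjoint_inner_left, L2.inner_eq,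
    OrientedGraph.bd2]
  simp only [faceOp_delta]
  refine tsum_eq_finsum ((finite_faces_mem s e).subset fun c hc h => hc ?_)
  simp only [h, mul_zero]

theorem adjoint_faceOp_delta_apply (c : (cayley s).Face D) (e : Γ × ι) :
    ContinuousLinearMap.adjoint (faceOp s D) (L2.delta c) e =
      OrientedGraph.walkChain c.boundaryWalk e := by
  rw [← L2.inner_delta_right, ContinuousLinearMap.adjoint_inner_left, L2.inner_delta_left,
    faceOp_delta]

/-- The boundary of each face is a finite cycle, and a square-summable combination is a limit of
finite ones. -/
theorem adjoint_faceOp_mem_l2c (φ : L2 ((cayley s).Face D)) :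
    ContinuousLinearMap.adjoint (faceOp s D) φ ∈ (cayley s).l2c := by
  have := Fintype.ofFinite ι
  have h1 := (L2.hasSum_delta φ).mapL (ContinuousLinearMap.adjoint (faceOp s D))
  refine (Submodule.isClosed_topologicalClosure _).mem_of_tendsto h1
    (Filter.Eventually.of_forall fun S => ?_)
  refine Submodule.sum_mem _ fun c _ => ?_
  rw [map_smul]
  refine Submodule.smul_mem _ _ (Submodule.le_topologicalClosure _ ?_)
  obtain ⟨v, hv⟩ := (boundaryWalk_spec s c).1.2.1
  exact mem_finiteCycles_of_walkChain s hv fun e => adjoint_faceOp_delta_apply s c e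

/-- Each translate of the loop bounds a face, so its integral is a value of `d f` up to sign.
Different translates may give the same face, but at most `D` times, because the position of the
first edge in the chosen boundary walk determines the starting point. -/
theorem norm_pathOp_le_of_isCycle {w : List (ι × Bool)}
    (hw : ∀ h, (cayley s).IsCycle (path s h w)) (hl : w.length ≤ D) (f : L2 (Γ × ι)) :
    ‖pathOp s w f‖ ≤ D * ‖faceOp s D f‖ := by
  classical
  obtain ⟨⟨i, b⟩, w', rfl⟩ : ∃ x w', w = x :: w' := by
    refine List.exists_cons_of_ne_nil ?_
    rintro rfl
    exact (hw 1).1 rfl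
  set w := (i, b) :: w'
  let F : Γ → (cayley s).Face D := fun h =>
    ⟨{e | e ∈ (path s h w).map Prod.fst}, path s h w, hw h, by simpa using hl, rfl⟩
  have hF : ∀ h e, e ∈ (F h).boundaryWalk.map Prod.fst ↔ e ∈ (path s h w).map Prod.fst := by
    intro h e
    have h1 := (boundaryWalk_spec s (F h)).2.2
    exact (Set.ext_iff.1 h1 e).symm
  have hk : ∀ h, ∃ k : Fin D, ∃ d, (F h).boundaryWalk[(k : ℕ)]? = some d ∧
      d.1 = (dart s h (i, b)).1 := by
    intro h
    have h1 : (dart s h (i, b)).1 ∈ (F h).boundaryWalk.map Prod.fst := by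
      rw [hF, path_cons]
      simp
    obtain ⟨d, hd, hdd⟩ := List.mem_map.1 h1
    obtain ⟨k, hk, rfl⟩ := List.mem_iff_getElem.1 hd
    exact ⟨⟨k, hk.trans_le (boundaryWalk_spec s (F h)).2.1⟩, _, List.getElem?_eq_getElem hk, hdd⟩
  choose k d hd hdd using hk
  have hinj : Function.Injective fun h => (F h, k h) := by
    intro h h' hh
    obtain ⟨h1, h2⟩ := Prod.mk.inj hh
    have h3 := hd h
    rw [h1, h2, hd h'] at h3
    have h4 : (dart s h' (i, b)).1 = (dart s h (i, b)).1 := by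
      rw [← hdd, ← hdd, Option.some.inj h3]
    cases b <;> simpa [dart, eq_comm] using h4
  have hle := L2.norm_le_of_abs_le hinj (pathOp s w f)
    (L2.stack (fun _ : Fin D => faceOp s D) f) fun h => by
      rw [L2.stack_apply, pathOp_apply, faceOp_apply]
      obtain ⟨κ, hκ, hκw⟩ := OrientedGraph.walkChain_eq_or_neg _ (hw h)
        (boundaryWalk_spec s (F h)).1 fun e he => (hF h e).1 he
      rw [OrientedGraph.integral_eq_sum_walkChain _ (path s h w)
        ((path s h w).map Prod.fst).toFinset fun e he => List.mem_toFinset.2 he,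
        OrientedGraph.integral_eq_sum_walkChain _ (F h).boundaryWalk
        ((path s h w).map Prod.fst).toFinset fun e he => List.mem_toFinset.2 ((hF h e).1 he)]
      simp only [hκw]
      rcases hκ with rfl | rfl <;> simp
  refine hle.trans ((L2.norm_stack_le _ _).trans ?_)
  simp

/-- In a simply connected complex, integrals along closed words are bounded by `d`. -/
theorem exists_norm_pathOp_le (hD : (cayley s).IsSimplyConnected D) {r : List (ι × Bool)}
    (hr : wordVal s r = 1) :
    ∃ C : ℝ, 0 ≤ C ∧ ∀ f, ‖pathOp s r f‖ ≤ C * ‖faceOp s D f‖ := by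
  have hwalk : (cayley s).IsWalk 1 (path s 1 r) 1 := by
    have := isWalk_path s 1 r
    rwa [hr, mul_one] at this
  -- Only the spelling of a path matters: a homotopy from the base point 1 is translated to all
  -- starting points at once, so each elementary step gives an operator estimate.
  have key : ∀ l l', Relation.EqvGen ((cayley s).HomotopyStep D 1 1) l l' →
      ∃ C : ℝ, 0 ≤ C ∧ ∀ f, ‖pathOp s (spell l) f - pathOp s (spell l') f‖ ≤
        C * ‖faceOp s D f‖ := by
    intro l l' h
    induction h with
    | refl l => exact ⟨0, le_rfl, fun f => by simp⟩
    | symm l l' _ ih =>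
      obtain ⟨C, hC, h⟩ := ih
      exact ⟨C, hC, fun f => by rw [norm_sub_rev]; exact h f⟩
    | trans l l' l'' _ _ ih ih' =>
      obtain ⟨C, hC, h⟩ := ih
      obtain ⟨C', hC', h'⟩ := ih'
      refine ⟨C + C', add_nonneg hC hC', fun f => ?_⟩
      rw [add_mul]
      exact (norm_sub_le_norm_sub_add_norm_sub _ (pathOp s (spell l') f) _).trans
        (add_le_add (h f) (h' f))
    | rel l l' h =>
      cases h with
      | backtrack p q e b hw =>
        refine ⟨0, le_rfl, fun f => ?_⟩
        rw [zero_mul, norm_le_zero_iff, sub_eq_zero]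
        ext h
        rw [pathOp_apply, pathOp_apply, spell_append, spell_append, spell_append, List.append_assoc,
          path_append, path_append, path_append, integral_append, integral_append,
          integral_append]
        have h1 : (spell [(e, b), (e, !b)] : List (ι × Bool)) =
            [(e.2, b)] ++ FreeGroup.invRev [(e.2, b)] := by
          simp [spell, FreeGroup.invRev]
        rw [h1, wordVal_append, wordVal_invRev, mul_inv_cancel, mul_one, path_append,
          integral_append, integral_path_invRev]
        ring
      | face p w q hw hc hl =>
        obtain ⟨v, hv⟩ := hc.2.1
        obtain ⟨e1, e2⟩ := eq_path_of_isWalk s hv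
        have e3 : wordVal s (spell w) = 1 := by simpa using e2
        have hc' : ∀ h, (cayley s).IsCycle (path s h (spell w)) := by
          intro h
          rw [e1] at hc
          have := isCycle_path_mul s (h * v⁻¹) v hc
          rwa [inv_mul_cancel_right] at this
        refine ⟨D, Nat.cast_nonneg _, fun f => ?_⟩
        -- Removing a face boundary changes the integral by that of the loop started after `p`, a
        -- right translate of `pathOp` of the loop.
        have e4 : pathOp s (spell (p ++ w ++ q)) f - pathOp s (spell (p ++ q)) f =
            L2.comp (fun h => h * wordVal s (spell p)) (mul_left_injective _)
              (pathOp s (spell w) f) := by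
          ext h
          rw [lp.coeFn_sub, Pi.sub_apply, L2.comp_apply, pathOp_apply, pathOp_apply, pathOp_apply,
            spell_append, spell_append, spell_append, path_append, path_append, path_append,
            wordVal_append, e3, mul_one, integral_append, integral_append, integral_append]
          ring
        rw [e4]
        refine (L2.norm_comp_le _ _ _).trans (norm_pathOp_le_of_isCycle s hc' ?_ f)
        rwa [spell, List.length_map]
  obtain ⟨C, hC, h⟩ := key _ _ (hD.2 1 _ hwalk)
  refine ⟨C, hC, fun f => ?_⟩
  have := h f
  rw [spell_path] at this
  simpa [spell, pathOp] using this

theorem exists_norm_pathOp_sub_le (hD : (cayley s).IsSimplyConnected D) {w w' : List (ι × Bool)}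
    (hw : wordVal s w = wordVal s w') :
    ∃ C : ℝ, 0 ≤ C ∧ ∀ f, ‖pathOp s w f - pathOp s w' f‖ ≤ C * ‖faceOp s D f‖ := by
  obtain ⟨C, hC, h⟩ := exists_norm_pathOp_le s hD (r := w ++ FreeGroup.invRev w') (by
    rw [wordVal_append, wordVal_invRev, hw, mul_inv_cancel])
  refine ⟨C, hC, fun f => ?_⟩
  have e : pathOp s w f - pathOp s w' f = pathOp s (w ++ FreeGroup.invRev w') f := by
    ext h
    rw [lp.coeFn_sub, Pi.sub_apply, pathOp_apply, pathOp_apply, pathOp_apply, path_append,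
      integral_append, hw, integral_path_invRev]
    ring
  rw [e]
  exact h f

/-- The spectral gap follows from a lower bound for `d`. -/
theorem hasCoexactSpectralGap_of_norm_le {C : ℝ} (hC : 0 < C)
    (h : ∀ f ∈ (cayley s).l2c, ‖f‖ ≤ C * ‖faceOp s D f‖) :
    (cayley s).HasCoexactSpectralGap D := by
  have := Fintype.ofFinite ι
  have : CompleteSpace (cayley s).l2c := Submodule.topologicalClosure.completeSpace _
  set A := faceOp s D
  let T : (cayley s).l2c →L[ℝ] (cayley s).l2c :=
    (ContinuousLinearMap.adjoint A ∘L A ∘L (cayley s).l2c.subtypeL).codRestrict _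
      fun f => adjoint_faceOp_mem_l2c s _
  have hT : ∀ f, ((T f : (cayley s).l2c) : L2 (Γ × ι)) = ContinuousLinearMap.adjoint A (A f) :=
    fun f => rfl
  refine ⟨T, fun f e => ?_, (C ^ 2)⁻¹, by positivity, ?_⟩
  · rw [hT, adjoint_faceOp_apply, OrientedGraph.hodgeLaplacian]
    -- On `ℓ²_{0,c}` the term `d∂` vanishes, so the Laplacian is `d*d`.
    have h1 : ∀ v, (cayley s).bd1 (f : L2 (Γ × ι)) v = 0 := bd1_eq_zero_of_mem_l2c s f.2
    have h2 : (A f : (cayley s).Face D → ℝ) = (cayley s).d1 D (f : L2 (Γ × ι)) :=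
      funext fun c => faceOp_apply s _ c
    rw [h2]
    simp [OrientedGraph.d0, h1]
  · rw [Set.eq_empty_iff_forall_notMem]
    rintro x ⟨hx, hx0, hx1⟩
    refine hx ?_
    -- For `x < C⁻²` the form of `x - d*d` is at most `-(C⁻² - x) ‖f‖²`, and coercivity gives
    -- invertibility.
    refine ContinuousLinearMap.isUnit_of_forall_le_norm_inner_map _
      (c := ((C ^ 2)⁻¹ - x).toNNReal) (Real.toNNReal_pos.2 (by linarith)) fun f => ?_
    have h1 : inner ℝ ((algebraMap ℝ ((cayley s).l2c →L[ℝ] (cayley s).l2c) x - T) f) f =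
        x * ‖f‖ ^ 2 - ‖A f‖ ^ 2 := by
      rw [sub_apply, inner_sub_left, Algebra.algebraMap_eq_smul_one,
        smul_apply, one_apply_eq_self, real_inner_smul_left,
        real_inner_self_eq_norm_sq, Submodule.coe_inner, hT,
        ContinuousLinearMap.adjoint_inner_left, real_inner_self_eq_norm_sq]
    have h2 : ‖f‖ ^ 2 ≤ C ^ 2 * ‖A f‖ ^ 2 := by
      rw [← mul_pow]
      exact pow_le_pow_left₀ (norm_nonneg _) (h f f.2) 2
    have h3 : (C ^ 2)⁻¹ * ‖f‖ ^ 2 ≤ ‖A f‖ ^ 2 := by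
      rwa [inv_mul_le_iff₀ (by positivity)]
    rw [h1, Real.norm_eq_abs, Real.coe_toNNReal _ (by linarith)]
    refine le_trans ?_ (neg_le_abs _)
    nlinarith

end FaceOp

/-! ### The lower bound for the differential with any generating system -/

section Gap

variable {g : ℕ} {ι : Type*} [Finite ι] (s : ι → SurfaceGroup g) {D : ℕ}

theorem closure_range_gen : Subgroup.closure (Set.range (gen (g := g))) = ⊤ :=
  PresentedGroup.closure_range_of _

/-- Split `‖f‖² = ⟨f, f - QPf⟩ + ⟨f, QPf⟩`, where `QP` rewrites the generators canonically and back;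
both terms are at most a constant times `‖f‖ ‖df‖`. -/
theorem exists_norm_le_faceOp (hg : 2 ≤ g) (hs : Subgroup.closure (Set.range s) = ⊤)
    (hD : (cayley s).IsSimplyConnected D) :
    ∃ C : ℝ, 0 < C ∧ ∀ f ∈ (cayley s).l2c, ‖f‖ ≤ C * ‖faceOp s D f‖ := by
  have := Fintype.ofFinite ι
  choose W hW using fun x : Gen g => exists_wordVal_eq s hs (gen x)
  choose U hU using fun i : ι => exists_wordVal_eq (gen (g := g)) closure_range_gen (s i)
  have hUW : ∀ i, wordVal s [(i, true)] = wordVal s (substWord W (U i)) := by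
    intro i
    rw [wordVal_substWord, funext hW]
    rw [hU]
    simp [letterVal]
  choose C₁ hC₁ hC₁' using fun i => exists_norm_pathOp_sub_le s hD (hUW i)
  obtain ⟨C₂, hC₂, hC₂'⟩ := exists_norm_pathOp_le s hD (r := substWord W (relWord g)) (by
    rw [wordVal_substWord, funext hW]
    exact wordVal_relWord)
  set P := substOp s W
  set Q := substOp (gen (g := g)) U
  set N := ‖ContinuousLinearMap.adjoint Q‖
  have hN : 0 ≤ N := norm_nonneg _
  have hS : 0 ≤ ∑ i, C₁ i := Finset.sum_nonneg fun i _ => hC₁ i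
  refine ⟨∑ i, C₁ i + 2 * N * C₂ + 1, by positivity, fun f hf => ?_⟩
  have h1 : ‖f - Q (P f)‖ ≤ (∑ i, C₁ i) * ‖faceOp s D f‖ := by
    have e : f - Q (P f) = L2.stack
        (fun i => pathOp s [(i, true)] - pathOp s (substWord W (U i))) f := by
      ext ⟨h, i⟩
      rw [L2.stack_apply, lp.coeFn_sub, Pi.sub_apply, sub_apply, lp.coeFn_sub,
        Pi.sub_apply, pathOp_apply, pathOp_apply, substOp_apply, integral_substOp s gen W hW]
      simp [path_cons, integral_cons, dart]
    rw [e, Finset.sum_mul]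
    exact (L2.norm_stack_le _ _).trans (Finset.sum_le_sum fun i _ => hC₁' i f)
  -- `Q` maps a coboundary to the coboundary of the same potential, so `Q*` preserves orthogonality
  -- to coboundaries and `Q*f` lies in the range of `boundaryOp`.
  obtain ⟨α, hα⟩ := exists_boundaryOp_eq hg (ContinuousLinearMap.adjoint Q f) (by
    intro u φ hu
    rw [ContinuousLinearMap.adjoint_inner_left]
    refine inner_coboundary_of_mem_l2c _ hf φ _ fun e => ?_
    rw [substOp_apply, funext hu, OrientedGraph.integral_d0 _ _ (isWalk_path gen e.1 (U e.2)), hU]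
    rfl)
  have h2 : ‖α‖ ≤ 2 * N * ‖f‖ := by
    have e1 := norm_sq_le_boundaryOp hg α
    rw [hα] at e1
    have e2 := (ContinuousLinearMap.adjoint Q).le_opNorm f
    have e3 := pow_le_pow_left₀ (norm_nonneg _) e2 2
    refine (sq_le_sq₀ (norm_nonneg _) (by positivity)).1 ?_
    have e4 : 0 ≤ (N * ‖f‖) ^ 2 := sq_nonneg _
    calc ‖α‖ ^ 2 ≤ 2 * (N * ‖f‖) ^ 2 := e1.trans (by gcongr)
      _ ≤ (2 * N * ‖f‖) ^ 2 := by nlinarith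
  have h3 : inner ℝ f (Q (P f)) ≤ 2 * N * ‖f‖ * (C₂ * ‖faceOp s D f‖) := by
    rw [← ContinuousLinearMap.adjoint_inner_left, ← hα, boundaryOp,
      ContinuousLinearMap.adjoint_inner_left]
    -- Integrating `P f` along the relator is integrating `f` along the relator rewritten in the
    -- letters of `s`, a closed word.
    have e : pathOp gen (relWord g) (P f) = pathOp s (substWord W (relWord g)) f := by
      ext m
      rw [pathOp_apply, pathOp_apply, integral_substOp s gen W hW]
    rw [e]
    refine (real_inner_le_norm _ _).trans ?_
    exact mul_le_mul h2 (hC₂' f) (norm_nonneg _) (by positivity)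
  have h4 : ‖f‖ ^ 2 = inner ℝ f (f - Q (P f)) + inner ℝ f (Q (P f)) := by
    rw [← inner_add_right, sub_add_cancel, real_inner_self_eq_norm_sq]
  have h5 : inner ℝ f (f - Q (P f)) ≤ ‖f‖ * ((∑ i, C₁ i) * ‖faceOp s D f‖) :=
    (real_inner_le_norm _ _).trans (mul_le_mul_of_nonneg_left h1 (norm_nonneg _))
  rcases eq_or_lt_of_le (norm_nonneg f) with h0 | h0
  · rw [← h0]
    positivity
  · refine le_of_mul_le_mul_left ?_ h0
    have h6 : 0 ≤ ‖f‖ * ‖faceOp s D f‖ := by positivity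
    nlinarith

end Gap

/-! ### Finite presentability and simple connectedness -/

section WordHomotopy

variable {Γ ι : Type*} [Group Γ] (s : ι → Γ) (D : ℕ)

/-- Two words are homotopic if they spell homotopic paths from every starting point. -/
def WordHomotopic (w w' : List (ι × Bool)) : Prop :=
  wordVal s w = wordVal s w' ∧ ∀ u,
    Relation.EqvGen ((cayley s).HomotopyStep D u (u * wordVal s w)) (path s u w) (path s u w')

/-- Homotopy of words as a congruence. -/
def wordCon : Con (FreeMonoid (ι × Bool)) where
  r w w' := WordHomotopic s D w.toList w'.toList
  iseqv :=
    { refl := fun w => ⟨rfl, fun u => .refl _⟩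
      symm := fun {w w'} h => ⟨h.1.symm, fun u => by rw [← h.1]; exact .symm _ _ (h.2 u)⟩
      trans := fun {w w' w''} h h' => ⟨h.1.trans h'.1, fun u =>
        .trans _ _ _ (h.2 u) (by rw [h.1]; exact h'.2 u)⟩ }
  mul' := by
    intro w₁ w₁' w₂ w₂' h₁ h₂
    refine ⟨by simp [h₁.1, h₂.1], fun u => ?_⟩
    rw [FreeMonoid.toList_mul, FreeMonoid.toList_mul, path_append, path_append, wordVal_append]
    have e1 := OrientedGraph.homotopic_append (h₁.2 u) (p := [])
      (rfl : (cayley s).IsWalk u [] u) (isWalk_path s (u * wordVal s w₁.toList) w₂.toList)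
    have e2 := OrientedGraph.homotopic_append (h₂.2 (u * wordVal s w₁.toList)) (q := [])
      (by rw [h₁.1]; exact isWalk_path s u w₁'.toList :
        (cayley s).IsWalk u (path s u w₁'.toList) (u * wordVal s w₁.toList)) rfl
    rw [← mul_assoc]
    refine .trans _ _ _ (by simpa using e1) ?_
    rw [← h₁.1]
    simpa using e2

/-- The homotopy class of a word. -/
def wordClass (w : List (ι × Bool)) : (wordCon s D).Quotient :=
  ((FreeMonoid.ofList w : FreeMonoid (ι × Bool)) : (wordCon s D).Quotient)

theorem wordClass_append (w w' : List (ι × Bool)) :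
    wordClass s D (w ++ w') = wordClass s D w * wordClass s D w' := by
  rw [wordClass, FreeMonoid.ofList_append, Con.coe_mul]
  rfl

theorem wordClass_eq_one_iff (w : List (ι × Bool)) :
    wordClass s D w = 1 ↔ WordHomotopic s D w [] := by
  rw [wordClass, ← Con.coe_one, Con.eq]
  rfl

variable {D}

theorem wordClass_eq_one {w : List (ι × Bool)} (hw : wordVal s w = 1) (hl : w.length ≤ D) :
    wordClass s D w = 1 := by
  rw [wordClass_eq_one_iff]
  refine ⟨hw, fun u => ?_⟩
  have h := isWalk_path s u w
  rw [hw, mul_one] at h ⊢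
  exact OrientedGraph.nullhomotopic_of_length_le h (by simpa using hl)

variable (hD : 2 ≤ D)

/-- The homomorphism that sends a word to its homotopy class. -/
def wordClassHom : FreeGroup ι →* (wordCon s D).Quotientˣ :=
  -- A letter followed by its inverse is a closed word of length 2, hence trivial as `2 ≤ D`; so
  -- classes of letters are units.
  FreeGroup.lift fun i =>
    { val := wordClass s D [(i, true)]
      inv := wordClass s D [(i, false)]
      val_inv := by
        rw [← wordClass_append]
        exact wordClass_eq_one s (by simp [letterVal]) (by simpa using hD)
      inv_val := by
        rw [← wordClass_append]
        exact wordClass_eq_one s (by simp [letterVal]) (by simpa using hD) }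

theorem wordClassHom_mk (w : List (ι × Bool)) :
    (wordClassHom s hD (FreeGroup.mk w) : (wordCon s D).Quotient) = wordClass s D w := by
  induction w with
  | nil => rw [← FreeGroup.one_eq_mk, map_one]; rfl
  | cons x w ih =>
    have h1 : FreeGroup.mk (x :: w) = FreeGroup.mk [x] * FreeGroup.mk w := by
      rw [FreeGroup.mul_mk]; rfl
    have h2 : x :: w = [x] ++ w := rfl
    rw [h1, map_mul, Units.val_mul, ih, h2, wordClass_append]
    congr 1
    obtain ⟨i, b⟩ := x
    cases b <;> simp [wordClassHom, FreeGroup.lift_mk]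

theorem wordClassHom_mk_eq_one {w : List (ι × Bool)} (hw : wordVal s w = 1)
    (hl : w.length ≤ D) : wordClassHom s hD (FreeGroup.mk w) = 1 := by
  rw [← Units.val_inj, wordClassHom_mk, wordClass_eq_one s hw hl]
  rfl

theorem mk_substWord {J : Type*} (W : J → List (ι × Bool)) (r : List (J × Bool)) :
    FreeGroup.mk (substWord W r) =
      FreeGroup.lift (fun j => FreeGroup.mk (W j)) (FreeGroup.mk r) := by
  induction r with
  | nil => rw [← FreeGroup.one_eq_mk, map_one]; rfl
  | cons x r ih =>
    have h1 : FreeGroup.mk (x :: r) = FreeGroup.mk [x] * FreeGroup.mk r := by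
      rw [FreeGroup.mul_mk]; rfl
    rw [h1, map_mul, ← ih, substWord, List.flatMap_cons, ← FreeGroup.mul_mk, ← substWord]
    congr 1
    obtain ⟨j, b⟩ := x
    cases b <;> simp [FreeGroup.lift_mk, FreeGroup.inv_mk]

end WordHomotopy

/-- The rewritten relator and the words identifying each `s i` with its canonical rewriting present
`Γ` on the generators `s`. Once `D` exceeds their lengths they are null-homotopic, so the class of a
word depends only on its value in `Γ`. -/
theorem exists_isSimplyConnected {g : ℕ} {ι : Type*} [Finite ι] (s : ι → SurfaceGroup g)
    (hs : Subgroup.closure (Set.range s) = ⊤) : ∃ D, (cayley s).IsSimplyConnected D := by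
  have := Fintype.ofFinite ι
  choose W hW using fun x : Gen g => exists_wordVal_eq s hs (gen x)
  choose U hU using fun i : ι => exists_wordVal_eq (gen (g := g)) closure_range_gen (s i)
  let R := substWord W (relWord g)
  let Z : ι → List (ι × Bool) := fun i => substWord W (U i) ++ [(i, false)]
  let D : ℕ := 2 + R.length + ∑ i, (Z i).length
  have hR : wordVal s R = 1 := by
    rw [wordVal_substWord, funext hW]
    exact wordVal_relWord
  have hZ : ∀ i, wordVal s (Z i) = 1 := by
    intro i
    rw [wordVal_append, wordVal_substWord, funext hW, hU]
    simp [letterVal]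
  have hD : 2 ≤ D := by omega
  have hRD : R.length ≤ D := by omega
  have hZD : ∀ i, (Z i).length ≤ D := by
    intro i
    have := Finset.single_le_sum (f := fun i => (Z i).length) (fun i _ => Nat.zero_le _)
      (Finset.mem_univ i)
    omega
  set θ := wordClassHom s hD
  have hlift : ∀ r : FreeGroup (Gen g), FreeGroup.lift (fun x => θ (FreeGroup.mk (W x))) r =
      θ (FreeGroup.lift (fun x => FreeGroup.mk (W x)) r) := by
    intro r
    have : FreeGroup.lift (fun x => θ (FreeGroup.mk (W x))) =
        θ.comp (FreeGroup.lift fun x => FreeGroup.mk (W x)) := by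
      ext x; simp
    rw [this]
    rfl
  have hrel : ∀ r ∈ ({surfaceRelator g} : Set (FreeGroup (Gen g))),
      FreeGroup.lift (fun x => θ (FreeGroup.mk (W x))) r = 1 := by
    rintro r rfl
    have h1 := wordClassHom_mk_eq_one s hD hR hRD
    rw [mk_substWord, ← hlift] at h1
    rw [← h1]
    exact congrArg _ surfaceRelator_eq_mk
  let ψ : SurfaceGroup g →* (wordCon s D).Quotientˣ := PresentedGroup.toGroup hrel
  have hψ : ∀ r, ψ (FreeGroup.lift gen r) = θ (FreeGroup.lift (fun x => FreeGroup.mk (W x)) r) := by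
    intro r
    rw [lift_gen_eq_mk, ← hlift]
    rfl
  -- The words `Z i` enter here: without them, the classes of the letters `s i` would not be
  -- determined by the canonical generators.
  have hψs : ψ.comp (FreeGroup.lift s) = θ := by
    ext i : 1
    rw [MonoidHom.comp_apply, FreeGroup.lift_apply_of, ← hU i, wordVal_eq_lift, hψ, ← mk_substWord]
    have h1 := wordClassHom_mk_eq_one s hD (hZ i) (hZD i)
    rw [← FreeGroup.mul_mk, map_mul] at h1
    have h2 : FreeGroup.mk [(i, false)] = (FreeGroup.of i)⁻¹ := rfl
    rw [h2, map_inv, mul_inv_eq_one] at h1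
    exact h1
  refine ⟨D, fun u v => ?_, fun v l hl => ?_⟩
  · obtain ⟨w, hw⟩ := exists_wordVal_eq s hs (u⁻¹ * v)
    refine ⟨path s u w, ?_⟩
    have := isWalk_path s u w
    rwa [hw, mul_inv_cancel_left] at this
  · obtain ⟨h1, h2⟩ := eq_path_of_isWalk s hl
    have h3 : wordVal s (spell l) = 1 := by simpa using h2
    have h4 : wordClass s D (spell l) = 1 := by
      rw [← wordClassHom_mk s hD]
      change ((θ (FreeGroup.mk (spell l)) : (wordCon s D).Quotientˣ) : (wordCon s D).Quotient) = 1
      rw [← hψs, MonoidHom.comp_apply, ← wordVal_eq_lift, h3, map_one]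
      rfl
    have h5 := ((wordClass_eq_one_iff s D _).1 h4).2 v
    rwa [h3, mul_one, ← h1] at h5

end CoexactGap

end

theorem mainTheorem7 (g : ℕ) (hg : 2 ≤ g) :
    (∀ T : CoexactGap.CanonicalTessellation g,
      CoexactGap.VertexCyclesFormRieszBasis T.tileCorner) ∧
    CoexactGap.VertexCyclesFormRieszBasis (CoexactGap.abstractCorner g) ∧
    ∀ (ι : Type) [Finite ι] (s : ι → CoexactGap.SurfaceGroup g),
      Subgroup.closure (Set.range s) = ⊤ →
      (∃ D : ℕ, (CoexactGap.cayley s).IsSimplyConnected D) ∧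
      ∀ D : ℕ, (CoexactGap.cayley s).IsSimplyConnected D →
        (CoexactGap.cayley s).HasCoexactSpectralGap D := by
  refine ⟨CoexactGap.vertexCyclesFormRieszBasis_tessellation hg,
    CoexactGap.vertexCyclesFormRieszBasis_abstract hg, fun ι _ s hs =>
    ⟨CoexactGap.exists_isSimplyConnected s hs, fun D hD => ?_⟩⟩
  obtain ⟨C, hC, h⟩ := CoexactGap.exists_norm_le_faceOp s hg hs hD
  exact CoexactGap.hasCoexactSpectralGap_of_norm_le s hC h
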